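/- Let $g_0=(g_{0\,\alpha\beta})$ be a constant symmetric invertible real $2\times2$ matrix, let $\epsilon=\pm1$, and consider the flat three-dimensional (pseudo-)Riemannian space with metric $g_{0\,\mu\nu}dx^\mu dx^\nu+\epsilon\,(dx^3)^2$. Let $U\subset\mathbb R^2$ be open, let $2\le k\le\infty$ or $k=\omega$ (real analytic), and let $\phi$ be a real function of class $C^{k+1}$ on $U$ (with $\infty+1=\infty$, $\omega+1=\omega$). On the graph $S_0=\{x^3=\phi(x^1,x^2)\}$ put $$h_{\alpha\beta}=g_{0\,\alpha\beta}+\epsilon\,\phi_{,\alpha}\phi_{,\beta},\qquad \rho=1+\epsilon\,g_0^{\mu\nu}\phi_{,\mu}\phi_{,\nu},\qquad H=\frac{1}{\sqrt{|\rho|}}\,h^{\mu\nu}\phi_{,\mu\nu},$$ $$g_{\alpha\beta}=\frac{h_{\alpha\beta}}{\sqrt{|\rho|}},\qquad w_1=(g_0)_{11}+\epsilon\,(\phi_{,1})^2,\qquad w_2=(g_0)_{22}+\epsilon\,(\phi_{,2})^2,$$ where $g_0^{\mu\nu}$ and $h^{\mu\nu}$ are the components of the inverse matrices (the absolute value is superfluous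 where $\rho>0$). Theorem. Assume that $\rho\neq0$ on $U$ and that $S_0$ is minimal, i.e. $H=0$ on $U$. Let $n\ge0$ be an integer, let $\epsilon_1,\dots,\epsilon_n\in\{1,-1\}$, and let $e_0,m_1,m_2,n_1,n_2$ be real constants with $$m_1+m_2=0,\qquad n_1+n_2=\frac{n-1}{2}.$$ For $i=1,2$ assume that $w_i\ne0$ on $U$ unless $m_i=n_i=0$ (in which case the powers of $w_i$ below are read as $1$). Then there are functions $\psi,\Phi$ on $U$ with $$e^{2\psi}=e^{2e_0\phi}\,|w_1|^{-2m_1}|w_2|^{-2m_2},\qquad e^{2\Phi}=e^{2\psi}\,|w_1|^{-2n_1}|w_2|^{-2n_2}\,|\rho|^{\,n_1+n_2},$$ and for them $$ds^2=e^{2\Phi}\,g_{\alpha\beta}\,dx^\alpha dx^\beta+\sum_{i=1}^n\epsilon_i\,g_{\alpha\beta}\,dy_i^\alpha dy_i^\beta$$ is a (nondegenerate) (pseudo-)Riemannian metric of class $C^k$ on the $(2+2n)$-dimensional manifold $U\times\mathbb R^{2n}$ whose Ricci tensor vanishes identically. By these formulas all its components are explicit in $\phi$, $\phi_{,1}$ and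 $\phi_{,2}$. -/

import Mathlib

namespace RicciFlatGraph

noncomputable section

/-! Classical tensor calculus in a global coordinate chart `ι → ℝ`. A metric is given by the
matrix field `G` of its components. -/

section Coordinates

variable {ι : Type*} [Fintype ι] [DecidableEq ι]

/-- The partial derivative `∂ᵢ f` at `x`. -/
def pd (i : ι) (f : (ι → ℝ) → ℝ) (x : ι → ℝ) : ℝ :=
  fderiv ℝ f x (Pi.single i 1)

/-- `Γᵏᵢⱼ = ½ Gᵏˡ (∂ᵢ Gₗⱼ + ∂ⱼ Gₗᵢ - ∂ₗ Gᵢⱼ)`. -/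
def christoffel (G : (ι → ℝ) → Matrix ι ι ℝ) (k i j : ι) (x : ι → ℝ) : ℝ :=
  (1 / 2) * ∑ l, (G x)⁻¹ k l *
    (pd i (fun z => G z l j) x + pd j (fun z => G z l i) x - pd l (fun z => G z i j) x)

/-- `Rᵢⱼ = ∂ₖ Γᵏᵢⱼ - ∂ⱼ Γᵏᵢₖ + Γᵏₖₗ Γˡᵢⱼ - Γᵏⱼₗ Γˡᵢₖ`. -/
def ricci (G : (ι → ℝ) → Matrix ι ι ℝ) (i j : ι) (x : ι → ℝ) : ℝ :=
  ∑ k, (pd k (christoffel G k i j) x - pd j (christoffel G k i k) x) +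
  ∑ k, ∑ l, (christoffel G k k l x * christoffel G l i j x -
    christoffel G k j l x * christoffel G l i k x)

/-- `G` is a (pseudo-)Riemannian metric of class `C^k` on `W`, of any signature. -/
structure IsPseudoRiemannianOn (k : WithTop ℕ∞) (G : (ι → ℝ) → Matrix ι ι ℝ)
    (W : Set (ι → ℝ)) : Prop where
  contDiffOn : ∀ i j, ContDiffOn ℝ k (fun x => G x i j) W
  symm : ∀ x ∈ W, (G x).IsSymm
  nondegenerate : ∀ x ∈ W, (G x).det ≠ 0

/-- The Ricci tensor of `G` vanishes at every point of `W`. -/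
def IsRicciFlatOn (G : (ι → ℝ) → Matrix ι ι ℝ) (W : Set (ι → ℝ)) : Prop :=
  ∀ x ∈ W, ∀ i j, ricci G i j x = 0

end Coordinates

/-! The graph `x³ = φ(x¹, x²)` in the flat space with metric
`g₀ μν dx^μ dx^ν + ε (dx³)²`. -/

/-- The induced metric `h μν = g₀ μν + ε ∂_μ φ ∂_ν φ`. -/
def graphMetric (g₀ : Matrix (Fin 2) (Fin 2) ℝ) (ε : ℝ) (φ : (Fin 2 → ℝ) → ℝ)
    (x : Fin 2 → ℝ) : Matrix (Fin 2) (Fin 2) ℝ :=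
  Matrix.of fun μ ν => g₀ μ ν + ε * pd μ φ x * pd ν φ x

/-- `ρ = 1 + ε g₀^{μν} ∂_μ φ ∂_ν φ`. -/
def rho (g₀ : Matrix (Fin 2) (Fin 2) ℝ) (ε : ℝ) (φ : (Fin 2 → ℝ) → ℝ) (x : Fin 2 → ℝ) : ℝ :=
  1 + ε * ∑ μ, ∑ ν, g₀⁻¹ μ ν * pd μ φ x * pd ν φ x

/-- The mean curvature `H = h^{μν} ∂_μ ∂_ν φ / √|ρ|`. -/
def meanCurvature (g₀ : Matrix (Fin 2) (Fin 2) ℝ) (ε : ℝ) (φ : (Fin 2 → ℝ) → ℝ)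
    (x : Fin 2 → ℝ) : ℝ :=
  1 / Real.sqrt |rho g₀ ε φ x| *
    ∑ μ, ∑ ν, (graphMetric g₀ ε φ x)⁻¹ μ ν * pd μ (pd ν φ) x

/-- The conformally related metric `g = h / √|ρ|`. -/
def conformalMetric (g₀ : Matrix (Fin 2) (Fin 2) ℝ) (ε : ℝ) (φ : (Fin 2 → ℝ) → ℝ)
    (x : Fin 2 → ℝ) : Matrix (Fin 2) (Fin 2) ℝ :=
  (1 / Real.sqrt |rho g₀ ε φ x|) • graphMetric g₀ ε φ x

/-- `w_α = (g₀)_αα + ε (∂_α φ)²`. -/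
def w (g₀ : Matrix (Fin 2) (Fin 2) ℝ) (ε : ℝ) (φ : (Fin 2 → ℝ) → ℝ) (α : Fin 2)
    (x : Fin 2 → ℝ) : ℝ :=
  g₀ α α + ε * pd α φ x ^ 2

/-! The `(2 + 2n)`-dimensional space. The index `Sum.inl α` stands for the coordinate `x^α`, and
`Sum.inr (α, i)` for the coordinate `y_i^α`. -/

/-- The projection `(x, y) ↦ x`. -/
def base {n : ℕ} (z : Fin 2 ⊕ Fin 2 × Fin n → ℝ) : Fin 2 → ℝ :=
  fun α => z (Sum.inl α)

/-- The metric `e^{2Φ} g_αβ dx^α dx^β + ∑ᵢ εᵢ g_αβ dyᵢ^α dyᵢ^β`, where `Φ` and `g` depend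
on `x` only. -/
def totalMetric {n : ℕ} (e : Fin n → ℝ) (g : (Fin 2 → ℝ) → Matrix (Fin 2) (Fin 2) ℝ)
    (Φ : (Fin 2 → ℝ) → ℝ) (z : Fin 2 ⊕ Fin 2 × Fin n → ℝ) :
    Matrix (Fin 2 ⊕ Fin 2 × Fin n) (Fin 2 ⊕ Fin 2 × Fin n) ℝ :=
  Matrix.fromBlocks (Real.exp (2 * Φ (base z)) • g (base z)) 0 0
    (Matrix.blockDiagonal fun i => e i • g (base z))

end

end RicciFlatGraph

/-! Minimality is used to show that `g = h / √|ρ|` is unimodular Hessian: `∂_a g_bc` is totally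
symmetric and `det g = ± det g₀` is locally constant (`isUnimodularHessian_conformalMetric`).
Everything else is geometry of such a metric, with Gauss curvature `K` and `Δ = g^{μν} ∂_μ ∂_ν`.

The total metric does not depend on the fibre coordinates, so its Ricci tensor splits into two
blocks. The base block is `Ric(e^{2Φ} g) - (n/4) tr(g⁻¹ ∂g g⁻¹ ∂g)`. Here `Ric(e^{2Φ} g) = (K - ΔΦ)
g` (`ricci_baseMetric`), and the trace is `4 K g` (`trace_logDeriv_mul`). The fibre block says that
the matrix field `g` is harmonic. This does not involve `Φ`, by conformal invariance in dimension
two, and it holds for every unimodular Hessian metric (`fibre_equation`).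

Ricci flatness therefore reduces to the linear equation `ΔΦ = (1 - n) K`. Solutions come from `Δφ =
0` (`laplacian_graph`) and `Δ log |g_cc| = 2K` (`laplacian_log`). Since `w_c = √|ρ| g_cc`, the
prescribed `Φ` is `e₀ φ - (m₁ + n₁) log |g_00| - (m₂ + n₂) log |g_11|` with indices from zero, and
the constraints on the constants give the right multiple of `K`. -/

namespace RicciFlatGraph

/-! ### Calculus of partial derivatives -/

section PartialDerivatives

set_option linter.unusedSectionVars false

variable {ι : Type*} [Fintype ι] [DecidableEq ι]

/-- `f` is differentiable at `x` with partial derivatives `d i`. -/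
def HasPD (f : (ι → ℝ) → ℝ) (d : ι → ℝ) (x : ι → ℝ) : Prop :=
  DifferentiableAt ℝ f x ∧ ∀ i, pd i f x = d i

theorem _root_.DifferentiableAt.hasPD {f : (ι → ℝ) → ℝ} {x : ι → ℝ}
    (hf : DifferentiableAt ℝ f x) : HasPD f (fun i => pd i f x) x :=
  ⟨hf, fun _ => rfl⟩

theorem HasPD.congr_deriv {f : (ι → ℝ) → ℝ} {d d' : ι → ℝ} {x : ι → ℝ}
    (h : HasPD f d x) (h' : ∀ i, d i = d' i) : HasPD f d' x :=
  ⟨h.1, fun i => (h.2 i).trans (h' i)⟩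

theorem HasPD.const (c : ℝ) (x : ι → ℝ) : HasPD (fun _ => c) (fun _ => 0) x :=
  ⟨differentiableAt_const c, fun i => by simp [pd]⟩

theorem HasPD.add {f g : (ι → ℝ) → ℝ} {d d' : ι → ℝ} {x : ι → ℝ}
    (hf : HasPD f d x) (hg : HasPD g d' x) :
    HasPD (fun z => f z + g z) (fun i => d i + d' i) x :=
  ⟨hf.1.add hg.1, fun i => by
    simp only [← hf.2 i, ← hg.2 i]; simp only [pd]; rw [fderiv_fun_add hf.1 hg.1]; rfl⟩

theorem HasPD.neg {f : (ι → ℝ) → ℝ} {d : ι → ℝ} {x : ι → ℝ} (hf : HasPD f d x) :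
    HasPD (fun z => -f z) (fun i => -d i) x :=
  ⟨hf.1.neg, fun i => by simp only [← hf.2 i]; simp only [pd]; rw [fderiv_fun_neg]; rfl⟩

theorem HasPD.sub {f g : (ι → ℝ) → ℝ} {d d' : ι → ℝ} {x : ι → ℝ}
    (hf : HasPD f d x) (hg : HasPD g d' x) :
    HasPD (fun z => f z - g z) (fun i => d i - d' i) x :=
  ⟨hf.1.sub hg.1, fun i => by
    simp only [← hf.2 i, ← hg.2 i]; simp only [pd]; rw [fderiv_fun_sub hf.1 hg.1]; rfl⟩

theorem HasPD.mul {f g : (ι → ℝ) → ℝ} {d d' : ι → ℝ} {x : ι → ℝ}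
    (hf : HasPD f d x) (hg : HasPD g d' x) :
    HasPD (fun z => f z * g z) (fun i => f x * d' i + g x * d i) x :=
  ⟨hf.1.mul hg.1, fun i => by
    simp only [← hf.2 i, ← hg.2 i]; simp only [pd]; rw [fderiv_fun_mul hf.1 hg.1]; rfl⟩

theorem HasPD.comp {F : ℝ → ℝ} {F' : ℝ} {f : (ι → ℝ) → ℝ} {d : ι → ℝ} {x : ι → ℝ}
    (hF : HasDerivAt F F' (f x)) (hf : HasPD f d x) :
    HasPD (fun z => F (f z)) (fun i => F' * d i) x := by
  have h := hF.comp_hasFDerivAt x hf.1.hasFDerivAt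
  refine ⟨h.differentiableAt, fun i => ?_⟩
  simp only [← hf.2 i]
  simp only [pd]
  rw [show (fun z => F (f z)) = F ∘ f from rfl, h.fderiv]
  simp

theorem HasPD.inv {f : (ι → ℝ) → ℝ} {d : ι → ℝ} {x : ι → ℝ} (hf : HasPD f d x)
    (h0 : f x ≠ 0) : HasPD (fun z => (f z)⁻¹) (fun i => -(f x)⁻¹ ^ 2 * d i) x :=
  (HasPD.comp (hasDerivAt_inv h0) hf).congr_deriv fun i => by rw [inv_pow]

theorem HasPD.exp {f : (ι → ℝ) → ℝ} {d : ι → ℝ} {x : ι → ℝ} (hf : HasPD f d x) :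
    HasPD (fun z => Real.exp (f z)) (fun i => Real.exp (f x) * d i) x :=
  HasPD.comp (Real.hasDerivAt_exp (f x)) hf

theorem HasPD.log {f : (ι → ℝ) → ℝ} {d : ι → ℝ} {x : ι → ℝ} (hf : HasPD f d x)
    (h0 : f x ≠ 0) : HasPD (fun z => Real.log (f z)) (fun i => (f x)⁻¹ * d i) x :=
  HasPD.comp (Real.hasDerivAt_log h0) hf

theorem HasPD.congr {f g : (ι → ℝ) → ℝ} {d : ι → ℝ} {x : ι → ℝ} {W : Set (ι → ℝ)}
    (hW : IsOpen W) (hx : x ∈ W) (hf : HasPD f d x) (h : ∀ z ∈ W, g z = f z) :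
    HasPD g d x := by
  have h' : g =ᶠ[nhds x] f := Filter.eventually_of_mem (hW.mem_nhds hx) h
  exact ⟨hf.1.congr_of_eventuallyEq h', fun i => by
    simp only [← hf.2 i]; simp only [pd]; rw [h'.fderiv_eq]⟩

theorem pd_congr {f g : (ι → ℝ) → ℝ} {x : ι → ℝ} {W : Set (ι → ℝ)} (i : ι)
    (hW : IsOpen W) (hx : x ∈ W) (h : ∀ z ∈ W, f z = g z) : pd i f x = pd i g x := by
  have h' : f =ᶠ[nhds x] g := Filter.eventually_of_mem (hW.mem_nhds hx) h
  simp only [pd]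
  rw [h'.fderiv_eq]

@[simp] theorem pd_const (i : ι) (c : ℝ) (x : ι → ℝ) : pd i (fun _ => c) x = 0 := by
  simp [pd]

theorem pd_fun_neg (i : ι) (f : (ι → ℝ) → ℝ) (x : ι → ℝ) :
    pd i (fun z => -f z) x = -pd i f x := by
  simp only [pd]; rw [fderiv_fun_neg]; rfl

theorem pd_const_mul (i : ι) (c : ℝ) (f : (ι → ℝ) → ℝ) (x : ι → ℝ) :
    pd i (fun z => c * f z) x = c * pd i f x := by
  simp only [pd]
  rw [show (fun z => c * f z) = c • f from rfl, fderiv_const_smul_field]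
  rfl

theorem contDiffOn_pd {f : (ι → ℝ) → ℝ} {U : Set (ι → ℝ)} {m k : WithTop ℕ∞}
    (hf : ContDiffOn ℝ k f U) (hU : IsOpen U) (hm : m + 1 ≤ k) (i : ι) :
    ContDiffOn ℝ m (pd i f) U :=
  (hf.fderiv_of_isOpen hU hm).clm_apply contDiffOn_const

theorem pd_comm {f : (ι → ℝ) → ℝ} {U : Set (ι → ℝ)} (hf : ContDiffOn ℝ 2 f U)
    (hU : IsOpen U) {x : ι → ℝ} (hx : x ∈ U) (i j : ι) :
    pd i (pd j f) x = pd j (pd i f) x := by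
  have h1 : DifferentiableAt ℝ (fderiv ℝ f) x :=
    ((hf.fderiv_of_isOpen hU (m := 1) (by norm_num)).differentiableOn (by simp)).differentiableAt
      (hU.mem_nhds hx)
  have h2 : IsSymmSndFDerivAt ℝ f x :=
    (hf.contDiffAt (hU.mem_nhds hx)).isSymmSndFDerivAt (by simp)
  have key : ∀ a b : ι, pd a (pd b f) x =
      fderiv ℝ (fderiv ℝ f) x (Pi.single a 1) (Pi.single b 1) := by
    intro a b
    change fderiv ℝ (fun z => fderiv ℝ f z (Pi.single b 1)) x (Pi.single a 1) = _
    rw [fderiv_clm_apply h1 (differentiableAt_const _)]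
    simp
  rw [key, key, h2.eq]

end PartialDerivatives

/-! ### Functions pulled back along the projection `base` -/

section Base

variable {n : ℕ}

/-- `base` as a continuous linear map. -/
noncomputable def baseCLM (n : ℕ) : (Fin 2 ⊕ Fin 2 × Fin n → ℝ) →L[ℝ] (Fin 2 → ℝ) :=
  ContinuousLinearMap.pi fun α => ContinuousLinearMap.proj (Sum.inl α)

theorem isOpen_base_preimage {U : Set (Fin 2 → ℝ)} (hU : IsOpen U) :
    IsOpen {z : Fin 2 ⊕ Fin 2 × Fin n → ℝ | base z ∈ U} :=
  hU.preimage (baseCLM n).continuous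

theorem contDiffOn_comp_base {f : (Fin 2 → ℝ) → ℝ} {U : Set (Fin 2 → ℝ)} {k : WithTop ℕ∞}
    (hf : ContDiffOn ℝ k f U) :
    ContDiffOn ℝ k (fun z : Fin 2 ⊕ Fin 2 × Fin n → ℝ => f (base z)) {z | base z ∈ U} :=
  hf.comp (baseCLM n).contDiff.contDiffOn fun _ hz => hz

/-- Differentiability of `f` is not needed: `base` has an affine section, so `f ∘ base` is
differentiable exactly where `f` is, and otherwise both sides take the default value zero. -/
theorem fderiv_comp_base (f : (Fin 2 → ℝ) → ℝ) (z : Fin 2 ⊕ Fin 2 × Fin n → ℝ) :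
    fderiv ℝ (fun z : Fin 2 ⊕ Fin 2 × Fin n → ℝ => f (base z)) z =
      (fderiv ℝ f (base z)).comp (baseCLM n) := by
  by_cases hf : DifferentiableAt ℝ f (base z)
  · exact (hf.hasFDerivAt.comp z (baseCLM n).hasFDerivAt).fderiv
  · rw [fderiv_zero_of_not_differentiableAt hf, fderiv_zero_of_not_differentiableAt]
    · simp
    · intro h
      apply hf
      let s : (Fin 2 → ℝ) → (Fin 2 ⊕ Fin 2 × Fin n → ℝ) := fun x =>
        Sum.elim x fun q => z (Sum.inr q)
      have hs : DifferentiableAt ℝ s (base z) := by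
        rw [differentiableAt_pi]
        rintro (a | q)
        · exact differentiableAt_apply a (base z)
        · exact differentiableAt_const _
      have hsz : s (base z) = z := by
        ext (a | q) <;> rfl
      rw [← hsz] at h
      exact h.comp (base z) hs

@[simp] theorem pd_inl_comp_base (f : (Fin 2 → ℝ) → ℝ) (α : Fin 2)
    (z : Fin 2 ⊕ Fin 2 × Fin n → ℝ) :
    pd (Sum.inl α) (fun z : Fin 2 ⊕ Fin 2 × Fin n → ℝ => f (base z)) z = pd α f (base z) := by
  simp only [pd]
  rw [fderiv_comp_base]
  have : baseCLM n (Pi.single (Sum.inl α) 1) = Pi.single α 1 := by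
    ext β
    simp [baseCLM, Pi.single_apply]
  simp [this]

@[simp] theorem pd_inr_comp_base (f : (Fin 2 → ℝ) → ℝ) (q : Fin 2 × Fin n)
    (z : Fin 2 ⊕ Fin 2 × Fin n → ℝ) :
    pd (Sum.inr q) (fun z : Fin 2 ⊕ Fin 2 × Fin n → ℝ => f (base z)) z = 0 := by
  simp only [pd]
  rw [fderiv_comp_base]
  have : baseCLM n (Pi.single (Sum.inr q) 1) = 0 := by
    ext β
    simp [baseCLM]
  simp [this]

end Base

/-! ### The Ricci tensor of the total metric -/

section TotalMetric

variable {n : ℕ}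

/-- The base part `e^{2Φ} g` of the total metric. -/
noncomputable def baseMetric (g : (Fin 2 → ℝ) → Matrix (Fin 2) (Fin 2) ℝ) (Φ : (Fin 2 → ℝ) → ℝ)
    (x : Fin 2 → ℝ) : Matrix (Fin 2) (Fin 2) ℝ :=
  Real.exp (2 * Φ x) • g x

/-- The components `(g⁻¹ ∂_b g)^a_c`. -/
noncomputable def logDeriv (g : (Fin 2 → ℝ) → Matrix (Fin 2) (Fin 2) ℝ) (b a c : Fin 2)
    (x : Fin 2 → ℝ) : ℝ :=
  ∑ l, (g x)⁻¹ a l * pd b (fun z => g z l c) x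

/-- The gradient of `g_bc` with respect to the metric `e^{2Φ} g`. -/
noncomputable def gradMetric (g : (Fin 2 → ℝ) → Matrix (Fin 2) (Fin 2) ℝ) (Φ : (Fin 2 → ℝ) → ℝ)
    (a b c : Fin 2) (x : Fin 2 → ℝ) : ℝ :=
  ∑ l, (baseMetric g Φ x)⁻¹ a l * pd l (fun z => g z b c) x

variable (e : Fin n → ℝ) (g : (Fin 2 → ℝ) → Matrix (Fin 2) (Fin 2) ℝ) (Φ : (Fin 2 → ℝ) → ℝ)

@[simp] theorem totalMetric_inl_inr (z : Fin 2 ⊕ Fin 2 × Fin n → ℝ) (a : Fin 2)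
    (q : Fin 2 × Fin n) : totalMetric e g Φ z (Sum.inl a) (Sum.inr q) = 0 := rfl

@[simp] theorem totalMetric_inr_inl (z : Fin 2 ⊕ Fin 2 × Fin n → ℝ) (a : Fin 2)
    (q : Fin 2 × Fin n) : totalMetric e g Φ z (Sum.inr q) (Sum.inl a) = 0 := rfl

theorem totalMetric_inr_inr (z : Fin 2 ⊕ Fin 2 × Fin n → ℝ) (a b : Fin 2) (i j : Fin n) :
    totalMetric e g Φ z (Sum.inr (a, i)) (Sum.inr (b, j)) =
      if i = j then e i * g (base z) a b else 0 := by
  simp [totalMetric, Matrix.blockDiagonal_apply]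

@[simp] theorem pd_inl_totalMetric_inl_inl (z : Fin 2 ⊕ Fin 2 × Fin n → ℝ) (m a b : Fin 2) :
    pd (Sum.inl m) (fun z => totalMetric e g Φ z (Sum.inl a) (Sum.inl b)) z =
      pd m (fun x => baseMetric g Φ x a b) (base z) :=
  pd_inl_comp_base (fun x => baseMetric g Φ x a b) m z

@[simp] theorem pd_inr_totalMetric_inl_inl (z : Fin 2 ⊕ Fin 2 × Fin n → ℝ) (q : Fin 2 × Fin n)
    (a b : Fin 2) :
    pd (Sum.inr q) (fun z => totalMetric e g Φ z (Sum.inl a) (Sum.inl b)) z = 0 :=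
  pd_inr_comp_base (fun x => baseMetric g Φ x a b) q z

@[simp] theorem pd_inl_totalMetric_inr_inr (z : Fin 2 ⊕ Fin 2 × Fin n → ℝ) (m a b : Fin 2)
    (i j : Fin n) :
    pd (Sum.inl m) (fun z => totalMetric e g Φ z (Sum.inr (a, i)) (Sum.inr (b, j))) z =
      if i = j then e i * pd m (fun x => g x a b) (base z) else 0 := by
  simp only [totalMetric_inr_inr]
  split_ifs
  · rw [pd_const_mul]
    exact congrArg _ (pd_inl_comp_base (fun x => g x a b) m z)
  · exact pd_const _ _ _

@[simp] theorem pd_inr_totalMetric_inr_inr (z : Fin 2 ⊕ Fin 2 × Fin n → ℝ) (q : Fin 2 × Fin n)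
    (a b : Fin 2) (i j : Fin n) :
    pd (Sum.inr q) (fun z => totalMetric e g Φ z (Sum.inr (a, i)) (Sum.inr (b, j))) z = 0 := by
  simp only [totalMetric_inr_inr]
  split_ifs
  · exact pd_inr_comp_base (fun x => e i * g x a b) q z
  · exact pd_const _ _ _

theorem det_baseMetric_ne_zero {x : Fin 2 → ℝ} (hg : (g x).det ≠ 0) :
    (baseMetric g Φ x).det ≠ 0 := by
  rw [baseMetric, Matrix.det_smul]
  exact mul_ne_zero (pow_ne_zero _ (Real.exp_ne_zero _)) hg

variable {e g}

theorem det_totalMetric_ne_zero (he : ∀ i, e i = 1 ∨ e i = -1)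
    {z : Fin 2 ⊕ Fin 2 × Fin n → ℝ} (hg : (g (base z)).det ≠ 0) :
    (totalMetric e g Φ z).det ≠ 0 := by
  rw [totalMetric, Matrix.det_fromBlocks_zero₁₂, Matrix.det_blockDiagonal]
  refine mul_ne_zero (det_baseMetric_ne_zero g Φ hg) (Finset.prod_ne_zero_iff.2 fun i _ => ?_)
  rw [Matrix.det_smul]
  refine mul_ne_zero (pow_ne_zero _ ?_) hg
  rcases he i with h | h <;> rw [h] <;> norm_num

/-- The sign `e i` is its own inverse, hence it reappears unchanged in the inverse block. -/
theorem inv_totalMetric (he : ∀ i, e i = 1 ∨ e i = -1)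
    {z : Fin 2 ⊕ Fin 2 × Fin n → ℝ} (hg : (g (base z)).det ≠ 0) :
    (totalMetric e g Φ z)⁻¹ = Matrix.fromBlocks (baseMetric g Φ (base z))⁻¹ 0 0
      (Matrix.blockDiagonal fun i => e i • (g (base z))⁻¹) := by
  apply Matrix.inv_eq_right_inv
  have h1 : baseMetric g Φ (base z) * (baseMetric g Φ (base z))⁻¹ = 1 :=
    Matrix.mul_nonsing_inv _ (det_baseMetric_ne_zero g Φ hg).isUnit
  have h2 : ∀ i, (e i • g (base z)) * (e i • (g (base z))⁻¹) = 1 := by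
    intro i
    rw [Matrix.smul_mul, Matrix.mul_smul, smul_smul, Matrix.mul_nonsing_inv _ hg.isUnit]
    rcases he i with h | h <;> rw [h] <;> norm_num
  rw [totalMetric, Matrix.fromBlocks_multiply, ← Matrix.blockDiagonal_mul]
  simp only [h2]
  rw [show Real.exp (2 * Φ (base z)) • g (base z) = baseMetric g Φ (base z) from rfl, h1]
  simp only [Matrix.mul_zero, Matrix.zero_mul, add_zero, zero_add]
  rw [show (fun _ : Fin n => (1 : Matrix (Fin 2) (Fin 2) ℝ)) = 1 from rfl,
    Matrix.blockDiagonal_one, Matrix.fromBlocks_one]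

variable (he : ∀ i, e i = 1 ∨ e i = -1) {z : Fin 2 ⊕ Fin 2 × Fin n → ℝ}
  (hg : (g (base z)).det ≠ 0)

include he hg

/-- In this and the following lemmas, symbols with an odd number of fibre indices vanish, as the
reflection `y ↦ -y` is an isometry. Those with two fibre indices only involve first derivatives of
`g`. -/
theorem christoffel_inl_inl_inl (a b c : Fin 2) :
    christoffel (totalMetric e g Φ) (Sum.inl a) (Sum.inl b) (Sum.inl c) z =
      christoffel (baseMetric g Φ) a b c (base z) := by
  simp [christoffel, inv_totalMetric Φ he hg, Fintype.sum_sum_type]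

theorem christoffel_inl_inl_inr (a b : Fin 2) (q : Fin 2 × Fin n) :
    christoffel (totalMetric e g Φ) (Sum.inl a) (Sum.inl b) (Sum.inr q) z = 0 := by
  simp [christoffel, inv_totalMetric Φ he hg, Fintype.sum_sum_type]

theorem christoffel_inl_inr_inl (a b : Fin 2) (q : Fin 2 × Fin n) :
    christoffel (totalMetric e g Φ) (Sum.inl a) (Sum.inr q) (Sum.inl b) z = 0 := by
  simp [christoffel, inv_totalMetric Φ he hg, Fintype.sum_sum_type]

theorem christoffel_inl_inr_inr (a b c : Fin 2) (i j : Fin n) :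
    christoffel (totalMetric e g Φ) (Sum.inl a) (Sum.inr (b, i)) (Sum.inr (c, j)) z =
      if i = j then -(e i / 2) * gradMetric g Φ a b c (base z) else 0 := by
  simp only [christoffel, inv_totalMetric Φ he hg, Fintype.sum_sum_type, gradMetric]
  split_ifs with h <;> simp [h]
  ring

theorem christoffel_inr_inl_inl (a b : Fin 2) (q : Fin 2 × Fin n) :
    christoffel (totalMetric e g Φ) (Sum.inr q) (Sum.inl a) (Sum.inl b) z = 0 := by
  simp [christoffel, inv_totalMetric Φ he hg, Fintype.sum_sum_type]

theorem christoffel_inr_inl_inr (a b c : Fin 2) (i j : Fin n) :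
    christoffel (totalMetric e g Φ) (Sum.inr (a, i)) (Sum.inl b) (Sum.inr (c, j)) z =
      if i = j then 1 / 2 * logDeriv g b a c (base z) else 0 := by
  have h1 : e i * e i = 1 := by rcases he i with h | h <;> rw [h] <;> norm_num
  simp only [christoffel, inv_totalMetric Φ he hg, Fintype.sum_sum_type, logDeriv]
  split_ifs with h
  · subst h
    simp [Fintype.sum_prod_type, Matrix.blockDiagonal_apply]
    linear_combination ((g (base z))⁻¹ a 0 * pd b (fun z => g z 0 c) (base z) +
      (g (base z))⁻¹ a 1 * pd b (fun z => g z 1 c) (base z)) * h1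
  · simp [Fintype.sum_prod_type, Matrix.blockDiagonal_apply, h]

theorem christoffel_inr_inr_inl (a b c : Fin 2) (i j : Fin n) :
    christoffel (totalMetric e g Φ) (Sum.inr (a, i)) (Sum.inr (c, j)) (Sum.inl b) z =
      if i = j then 1 / 2 * logDeriv g b a c (base z) else 0 := by
  rw [← christoffel_inr_inl_inr Φ he hg a b c i j]
  simp [christoffel, inv_totalMetric Φ he hg, Fintype.sum_sum_type]

theorem christoffel_inr_inr_inr (q r s : Fin 2 × Fin n) :
    christoffel (totalMetric e g Φ) (Sum.inr q) (Sum.inr r) (Sum.inr s) z = 0 := by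
  obtain ⟨a, i⟩ := q
  obtain ⟨b, j⟩ := r
  obtain ⟨c, k⟩ := s
  simp [christoffel, inv_totalMetric Φ he hg, Fintype.sum_sum_type]

end TotalMetric

/-! ### Block decomposition of the Ricci tensor of the total metric. -/

section TotalRicci

variable {n : ℕ} {e : Fin n → ℝ} {g : (Fin 2 → ℝ) → Matrix (Fin 2) (Fin 2) ℝ}
  (Φ : (Fin 2 → ℝ) → ℝ) {U : Set (Fin 2 → ℝ)}

theorem pd_inl_of_eq_comp_base {f : (Fin 2 ⊕ Fin 2 × Fin n → ℝ) → ℝ} {F : (Fin 2 → ℝ) → ℝ}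
    (hU : IsOpen U) (h : ∀ z, base z ∈ U → f z = F (base z))
    {z : Fin 2 ⊕ Fin 2 × Fin n → ℝ} (hz : base z ∈ U) (m : Fin 2) :
    pd (Sum.inl m) f z = pd m F (base z) :=
  (pd_congr _ (isOpen_base_preimage hU) hz h).trans (pd_inl_comp_base F m z)

theorem pd_inr_of_eq_comp_base {f : (Fin 2 ⊕ Fin 2 × Fin n → ℝ) → ℝ} {F : (Fin 2 → ℝ) → ℝ}
    (hU : IsOpen U) (h : ∀ z, base z ∈ U → f z = F (base z))
    {z : Fin 2 ⊕ Fin 2 × Fin n → ℝ} (hz : base z ∈ U) (q : Fin 2 × Fin n) :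
    pd (Sum.inr q) f z = 0 :=
  (pd_congr _ (isOpen_base_preimage hU) hz h).trans (pd_inr_comp_base F q z)

/-- All Christoffel symbols of the total metric depend on the base point only. -/
theorem christoffel_eq_comp_base (he : ∀ i, e i = 1 ∨ e i = -1) (hg : ∀ x ∈ U, (g x).det ≠ 0)
    (k i j : Fin 2 ⊕ Fin 2 × Fin n) : ∃ F : (Fin 2 → ℝ) → ℝ,
      ∀ z, base z ∈ U → christoffel (totalMetric e g Φ) k i j z = F (base z) := by
  rcases k with a | ⟨a, k⟩ <;> rcases i with b | ⟨b, i⟩ <;> rcases j with c | ⟨c, j⟩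
  · exact ⟨_, fun z hz => christoffel_inl_inl_inl Φ he (hg _ hz) a b c⟩
  · exact ⟨fun _ => 0, fun z hz => christoffel_inl_inl_inr Φ he (hg _ hz) a b _⟩
  · exact ⟨fun _ => 0, fun z hz => christoffel_inl_inr_inl Φ he (hg _ hz) a c _⟩
  · exact ⟨fun x => if i = j then -(e i / 2) * gradMetric g Φ a b c x else 0,
      fun z hz => christoffel_inl_inr_inr Φ he (hg _ hz) a b c i j⟩
  · exact ⟨fun _ => 0, fun z hz => christoffel_inr_inl_inl Φ he (hg _ hz) b c _⟩
  · exact ⟨fun x => if k = j then 1 / 2 * logDeriv g b a c x else 0,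
      fun z hz => christoffel_inr_inl_inr Φ he (hg _ hz) a b c k j⟩
  · exact ⟨fun x => if k = i then 1 / 2 * logDeriv g c a b x else 0,
      fun z hz => christoffel_inr_inr_inl Φ he (hg _ hz) a c b k i⟩
  · exact ⟨fun _ => 0, fun z hz => christoffel_inr_inr_inr Φ he (hg _ hz) _ _ _⟩

variable (hU : IsOpen U) (he : ∀ i, e i = 1 ∨ e i = -1) (hg : ∀ x ∈ U, (g x).det ≠ 0)
  {z : Fin 2 ⊕ Fin 2 × Fin n → ℝ} (hz : base z ∈ U)

include hU he hg hz

theorem pd_inr_christoffel (q : Fin 2 × Fin n) (k i j : Fin 2 ⊕ Fin 2 × Fin n) :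
    pd (Sum.inr q) (christoffel (totalMetric e g Φ) k i j) z = 0 := by
  obtain ⟨F, hF⟩ := christoffel_eq_comp_base Φ he hg k i j
  exact pd_inr_of_eq_comp_base hU hF hz q

theorem pd_inl_christoffel_inl_inl_inl (m a b c : Fin 2) :
    pd (Sum.inl m) (christoffel (totalMetric e g Φ) (Sum.inl a) (Sum.inl b) (Sum.inl c)) z =
      pd m (christoffel (baseMetric g Φ) a b c) (base z) :=
  pd_inl_of_eq_comp_base hU (fun _ h => christoffel_inl_inl_inl Φ he (hg _ h) a b c) hz m

theorem pd_inl_christoffel_inl_inl_inr (m a b : Fin 2) (q : Fin 2 × Fin n) :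
    pd (Sum.inl m) (christoffel (totalMetric e g Φ) (Sum.inl a) (Sum.inl b) (Sum.inr q)) z = 0 :=
  (pd_inl_of_eq_comp_base (F := fun _ => 0) hU
    (fun _ h => christoffel_inl_inl_inr Φ he (hg _ h) a b q) hz m).trans (pd_const _ _ _)

theorem pd_inl_christoffel_inl_inr_inl (m a b : Fin 2) (q : Fin 2 × Fin n) :
    pd (Sum.inl m) (christoffel (totalMetric e g Φ) (Sum.inl a) (Sum.inr q) (Sum.inl b)) z = 0 :=
  (pd_inl_of_eq_comp_base (F := fun _ => 0) hU
    (fun _ h => christoffel_inl_inr_inl Φ he (hg _ h) a b q) hz m).trans (pd_const _ _ _)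

theorem pd_inl_christoffel_inl_inr_inr (m a b c : Fin 2) (i j : Fin n) :
    pd (Sum.inl m) (christoffel (totalMetric e g Φ) (Sum.inl a) (Sum.inr (b, i))
      (Sum.inr (c, j))) z =
      if i = j then -(e i / 2) * pd m (gradMetric g Φ a b c) (base z) else 0 := by
  rw [pd_inl_of_eq_comp_base
    (F := fun x => if i = j then -(e i / 2) * gradMetric g Φ a b c x else 0) hU
    (fun _ h => christoffel_inl_inr_inr Φ he (hg _ h) a b c i j) hz m]
  split_ifs
  · exact pd_const_mul _ _ _ _
  · exact pd_const _ _ _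

theorem pd_inl_christoffel_inr_inl_inr (m a b c : Fin 2) (i j : Fin n) :
    pd (Sum.inl m) (christoffel (totalMetric e g Φ) (Sum.inr (a, i)) (Sum.inl b)
      (Sum.inr (c, j))) z =
      if i = j then 1 / 2 * pd m (logDeriv g b a c) (base z) else 0 := by
  rw [pd_inl_of_eq_comp_base
    (F := fun x => if i = j then 1 / 2 * logDeriv g b a c x else 0) hU
    (fun _ h => christoffel_inr_inl_inr Φ he (hg _ h) a b c i j) hz m]
  split_ifs
  · exact pd_const_mul _ _ _ _
  · exact pd_const _ _ _

theorem pd_inl_christoffel_inr_inr_inr (m : Fin 2) (q r s : Fin 2 × Fin n) :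
    pd (Sum.inl m) (christoffel (totalMetric e g Φ) (Sum.inr q) (Sum.inr r)
      (Sum.inr s)) z = 0 :=
  (pd_inl_of_eq_comp_base (F := fun _ => 0) hU
    (fun _ h => christoffel_inr_inr_inr Φ he (hg _ h) q r s) hz m).trans (pd_const _ _ _)

theorem ricci_inl_inr (b : Fin 2) (q : Fin 2 × Fin n) :
    ricci (totalMetric e g Φ) (Sum.inl b) (Sum.inr q) z = 0 := by
  obtain ⟨c, j⟩ := q
  simp [ricci, Fintype.sum_sum_type, pd_inr_christoffel Φ hU he hg hz,
    pd_inl_christoffel_inl_inl_inr Φ hU he hg hz, christoffel_inl_inl_inr Φ he (hg _ hz),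
    christoffel_inl_inr_inl Φ he (hg _ hz), christoffel_inr_inl_inl Φ he (hg _ hz),
    christoffel_inr_inr_inr Φ he (hg _ hz)]

theorem ricci_inr_inl (b : Fin 2) (q : Fin 2 × Fin n) :
    ricci (totalMetric e g Φ) (Sum.inr q) (Sum.inl b) z = 0 := by
  obtain ⟨c, j⟩ := q
  simp [ricci, Fintype.sum_sum_type, pd_inr_christoffel Φ hU he hg hz,
    pd_inl_christoffel_inl_inr_inl Φ hU he hg hz, christoffel_inl_inl_inr Φ he (hg _ hz),
    christoffel_inl_inr_inl Φ he (hg _ hz), christoffel_inr_inl_inl Φ he (hg _ hz),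
    christoffel_inr_inr_inr Φ he (hg _ hz), pd_inl_christoffel_inr_inr_inr Φ hU he hg hz]

variable (htr : ∀ b, ∀ x ∈ U, logDeriv g b 0 0 x + logDeriv g b 1 1 x = 0)

include htr

/-- Each fibre pair contributes `-1/4` of the trace through the products of two mixed Christoffel
symbols. The remaining contributions contain `tr (g⁻¹ ∂g)`, which `htr` removes. -/
theorem ricci_inl_inl (b c : Fin 2) :
    ricci (totalMetric e g Φ) (Sum.inl b) (Sum.inl c) z =
      ricci (baseMetric g Φ) b c (base z) -
        n / 4 * ∑ a, ∑ d, logDeriv g c a d (base z) * logDeriv g b d a (base z) := by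
  have h1 : ∀ b, logDeriv g b 1 1 (base z) = -logDeriv g b 0 0 (base z) := fun b => by
    linarith [htr b _ hz]
  have h2 : pd c (logDeriv g b 1 1) (base z) = -pd c (logDeriv g b 0 0) (base z) := by
    rw [← pd_fun_neg]
    exact pd_congr _ hU hz fun x hx => by linarith [htr b x hx]
  simp only [ricci, Fintype.sum_sum_type, Fintype.sum_prod_type, Fin.sum_univ_two,
    pd_inr_christoffel Φ hU he hg hz,
    pd_inl_christoffel_inl_inl_inl Φ hU he hg hz, pd_inl_christoffel_inr_inl_inr Φ hU he hg hz,
    christoffel_inl_inl_inr Φ he (hg _ hz), christoffel_inl_inl_inl Φ he (hg _ hz),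
    christoffel_inr_inl_inl Φ he (hg _ hz),
    christoffel_inr_inr_inr Φ he (hg _ hz), christoffel_inr_inl_inr Φ he (hg _ hz),
    christoffel_inr_inr_inl Φ he (hg _ hz), h1, h2]
  simp
  ring

/-- The bracket is the same for all fibres, so a single matrix equation on the base controls the
whole fibre block. -/
theorem ricci_inr_inr (b c : Fin 2) (i j : Fin n) :
    ricci (totalMetric e g Φ) (Sum.inr (b, i)) (Sum.inr (c, j)) z =
      if i = j then -(e i / 2) * (∑ a, pd a (gradMetric g Φ a b c) (base z) +
        ∑ k, ∑ l, (christoffel (baseMetric g Φ) k k l (base z) * gradMetric g Φ l b c (base z) -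
          1 / 2 * gradMetric g Φ k c l (base z) * logDeriv g k l b (base z) -
          1 / 2 * logDeriv g l k c (base z) * gradMetric g Φ l b k (base z))) else 0 := by
  have h1 : ∀ b, logDeriv g b 1 1 (base z) = -logDeriv g b 0 0 (base z) := fun b => by
    linarith [htr b _ hz]
  simp only [ricci, Fintype.sum_sum_type, Fintype.sum_prod_type, Fin.sum_univ_two,
    pd_inr_christoffel Φ hU he hg hz,
    pd_inl_christoffel_inl_inr_inr Φ hU he hg hz,
    christoffel_inl_inl_inr Φ he (hg _ hz), christoffel_inl_inl_inl Φ he (hg _ hz),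
    christoffel_inl_inr_inl Φ he (hg _ hz), christoffel_inl_inr_inr Φ he (hg _ hz),
    christoffel_inr_inr_inr Φ he (hg _ hz), 
    christoffel_inr_inr_inl Φ he (hg _ hz), h1]
  by_cases h : i = j
  · subst h
    simp [Finset.sum_add_distrib, Finset.sum_sub_distrib]
    ring
  · have h' : ¬ j = i := fun h' => h h'.symm
    simp [h, h', Finset.sum_add_distrib]

end TotalRicci

/-! ### Two-dimensional Hessian metrics of constant determinant -/

/-- `g` is a nondegenerate symmetric matrix field of class `C²` on `U ⊆ ℝ²` which is locally a
Hessian (`∂_a g_bc` is totally symmetric) and whose determinant is locally constant. -/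
structure IsUnimodularHessian (g : (Fin 2 → ℝ) → Matrix (Fin 2) (Fin 2) ℝ)
    (U : Set (Fin 2 → ℝ)) : Prop where
  isOpen : IsOpen U
  contDiffOn : ∀ a b, ContDiffOn ℝ 2 (fun x => g x a b) U
  symm : ∀ x ∈ U, g x 1 0 = g x 0 1
  det_ne_zero : ∀ x ∈ U, (g x).det ≠ 0
  pd_one_zero : ∀ x ∈ U, pd 1 (fun x => g x 0 0) x = pd 0 (fun x => g x 0 1) x
  pd_one_one : ∀ x ∈ U, pd 1 (fun x => g x 0 1) x = pd 0 (fun x => g x 1 1) x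
  pd_det : ∀ m, ∀ x ∈ U, g x 1 1 * pd m (fun x => g x 0 0) x -
    2 * g x 0 1 * pd m (fun x => g x 0 1) x + g x 0 0 * pd m (fun x => g x 1 1) x = 0

/-- The Laplacian `g^{μν} ∂_μ ∂_ν f`; for a Hessian metric of constant determinant this is the
Laplace-Beltrami operator. -/
noncomputable def laplacian (g : (Fin 2 → ℝ) → Matrix (Fin 2) (Fin 2) ℝ) (f : (Fin 2 → ℝ) → ℝ)
    (x : Fin 2 → ℝ) : ℝ :=
  (g x).det⁻¹ * (g x 1 1 * pd 0 (pd 0 f) x - 2 * g x 0 1 * pd 0 (pd 1 f) x +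
    g x 0 0 * pd 1 (pd 1 f) x)

/-- The Gauss curvature of a Hessian metric of constant determinant. -/
noncomputable def gaussCurvature (g : (Fin 2 → ℝ) → Matrix (Fin 2) (Fin 2) ℝ)
    (x : Fin 2 → ℝ) : ℝ :=
  -(1 / 4) * (g x).det⁻¹ ^ 2 *
    (g x 1 1 * (pd 0 (fun x => g x 0 0) x * pd 0 (fun x => g x 1 1) x -
      pd 0 (fun x => g x 0 1) x ^ 2) -
    g x 0 1 * (pd 0 (fun x => g x 0 0) x * pd 1 (fun x => g x 1 1) x -
      pd 0 (fun x => g x 0 1) x * pd 0 (fun x => g x 1 1) x) +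
    g x 0 0 * (pd 0 (fun x => g x 0 1) x * pd 1 (fun x => g x 1 1) x -
      pd 0 (fun x => g x 1 1) x ^ 2))

namespace IsUnimodularHessian

variable {g : (Fin 2 → ℝ) → Matrix (Fin 2) (Fin 2) ℝ} {U : Set (Fin 2 → ℝ)}
  (h : IsUnimodularHessian g U) {x : Fin 2 → ℝ} (hx : x ∈ U)

include h hx

theorem det_eq : (g x).det = g x 0 0 * g x 1 1 - g x 0 1 ^ 2 := by
  rw [Matrix.det_fin_two, h.symm x hx]; ring

theorem hasPD (a b : Fin 2) :
    HasPD (fun x => g x a b) (fun m => pd m (fun x => g x a b) x) x :=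
  (((h.contDiffOn a b).differentiableOn (by norm_num)).differentiableAt
    (h.isOpen.mem_nhds hx)).hasPD

theorem hasPD_pd (m a b : Fin 2) :
    HasPD (pd m (fun x => g x a b)) (fun l => pd l (pd m (fun x => g x a b)) x) x :=
  (((contDiffOn_pd (h.contDiffOn a b) h.isOpen (m := 1) (by norm_num) m).differentiableOn
    (by norm_num)).differentiableAt (h.isOpen.mem_nhds hx)).hasPD

theorem pd_symm (m : Fin 2) : pd m (fun x => g x 1 0) x = pd m (fun x => g x 0 1) x :=
  pd_congr m h.isOpen hx h.symm

theorem pd_pd_symm (l m : Fin 2) :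
    pd l (pd m (fun x => g x 1 0)) x = pd l (pd m (fun x => g x 0 1)) x :=
  pd_congr l h.isOpen hx fun _ hy => h.pd_symm hy m

theorem pd_pd_one_zero (m : Fin 2) :
    pd m (pd 1 (fun x => g x 0 0)) x = pd m (pd 0 (fun x => g x 0 1)) x :=
  pd_congr m h.isOpen hx h.pd_one_zero

theorem pd_pd_one_one (m : Fin 2) :
    pd m (pd 1 (fun x => g x 0 1)) x = pd m (pd 0 (fun x => g x 1 1)) x :=
  pd_congr m h.isOpen hx h.pd_one_one

theorem pd_one_pd_zero_00 :
    pd 1 (pd 0 (fun x => g x 0 0)) x = pd 0 (pd 0 (fun x => g x 0 1)) x := by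
  rw [pd_comm (h.contDiffOn 0 0) h.isOpen hx, h.pd_pd_one_zero hx]

theorem pd_one_pd_zero_01 :
    pd 1 (pd 0 (fun x => g x 0 1)) x = pd 0 (pd 0 (fun x => g x 1 1)) x := by
  rw [pd_comm (h.contDiffOn 0 1) h.isOpen hx, h.pd_pd_one_one hx]

theorem pd_zero_pd_one_11 :
    pd 0 (pd 1 (fun x => g x 1 1)) x = pd 1 (pd 0 (fun x => g x 1 1)) x :=
  pd_comm (h.contDiffOn 1 1) h.isOpen hx 0 1

theorem pd_pd_det (l m : Fin 2) :
    g x 1 1 * pd l (pd m (fun x => g x 0 0)) x + pd m (fun x => g x 0 0) x *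
        pd l (fun x => g x 1 1) x -
      2 * (g x 0 1 * pd l (pd m (fun x => g x 0 1)) x + pd m (fun x => g x 0 1) x *
        pd l (fun x => g x 0 1) x) +
      (g x 0 0 * pd l (pd m (fun x => g x 1 1)) x + pd m (fun x => g x 1 1) x *
        pd l (fun x => g x 0 0) x) = 0 := by
  have h1 := ((((h.hasPD hx 1 1).mul (h.hasPD_pd hx m 0 0)).sub
    ((HasPD.const 2 x).mul ((h.hasPD hx 0 1).mul (h.hasPD_pd hx m 0 1)))).add
    ((h.hasPD hx 0 0).mul (h.hasPD_pd hx m 1 1))).2 l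
  have h2 := (pd_congr l h.isOpen hx (g := fun _ => 0) fun y hy =>
    (by linear_combination h.pd_det m y hy :
      g y 1 1 * pd m (fun x => g x 0 0) y - 2 * (g y 0 1 * pd m (fun x => g x 0 1) y) +
        g y 0 0 * pd m (fun x => g x 1 1) y = 0)).trans (pd_const l 0 x)
  rw [h2] at h1
  linear_combination -h1

theorem hasPD_inv_det : HasPD (fun x => (g x).det⁻¹) (fun _ => 0) x := by
  have h1 := ((((h.hasPD hx 0 0).mul (h.hasPD hx 1 1)).sub
    ((h.hasPD hx 0 1).mul (h.hasPD hx 0 1))).congr h.isOpen hx (g := fun x => (g x).det)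
    fun y hy => by rw [h.det_eq hy]; ring)
  exact (h1.inv (h.det_ne_zero x hx)).congr_deriv fun m => by
    linear_combination (-(g x).det⁻¹ ^ 2) * h.pd_det m x hx

/-- The determinant is locally constant and the adjugate of a 2×2 matrix is linear in its entries,
so the adjugate may be differentiated entrywise. -/
theorem hasPD_inv (a b : Fin 2) : HasPD (fun x => (g x)⁻¹ a b)
    (fun m => (g x).det⁻¹ * (Matrix.of fun a b => pd m (fun x => g x a b) x).adjugate a b) x := by
  have hd := h.hasPD_inv_det hx
  simp only [Matrix.inv_def, Ring.inverse_eq_inv', Matrix.adjugate_fin_two, Matrix.smul_apply,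
    smul_eq_mul]
  fin_cases a <;> fin_cases b
  · exact (hd.mul (h.hasPD hx 1 1)).congr_deriv fun m => by simp
  · exact (hd.mul (h.hasPD hx 0 1).neg).congr_deriv fun m => by simp
  · exact (hd.mul (h.hasPD hx 1 0).neg).congr_deriv fun m => by simp
  · exact (hd.mul (h.hasPD hx 0 0)).congr_deriv fun m => by simp

theorem trace_logDeriv (b : Fin 2) : logDeriv g b 0 0 x + logDeriv g b 1 1 x = 0 := by
  simp [logDeriv, Matrix.inv_def, Matrix.adjugate_fin_two, h.symm x hx, h.pd_symm hx]
  linear_combination (g x).det⁻¹ * h.pd_det b x hx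

/-- The discriminants of the cubic form `∂_a g_bc` are multiples of the components of `g`. -/
theorem gaussCurvature_mul :
    gaussCurvature g x * g x 0 0 = -(1 / 2) * (g x).det⁻¹ *
      (pd 0 (fun x => g x 0 0) x * pd 0 (fun x => g x 1 1) x - pd 0 (fun x => g x 0 1) x ^ 2) ∧
    gaussCurvature g x * g x 0 1 = -(1 / 4) * (g x).det⁻¹ *
      (pd 0 (fun x => g x 0 0) x * pd 1 (fun x => g x 1 1) x -
        pd 0 (fun x => g x 0 1) x * pd 0 (fun x => g x 1 1) x) ∧
    gaussCurvature g x * g x 1 1 = -(1 / 2) * (g x).det⁻¹ *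
      (pd 0 (fun x => g x 0 1) x * pd 1 (fun x => g x 1 1) x - pd 0 (fun x => g x 1 1) x ^ 2) := by
  have h0 := h.pd_det 0 x hx
  have h1 := h.pd_det 1 x hx
  rw [h.pd_one_zero x hx, h.pd_one_one x hx] at h1
  have hi : (g x).det⁻¹ * (g x 0 0 * g x 1 1 - g x 0 1 ^ 2) = 1 := by
    rw [← h.det_eq hx]; exact inv_mul_cancel₀ (h.det_ne_zero x hx)
  simp only [gaussCurvature]
  generalize (g x).det⁻¹ = i at *
  generalize pd 0 (fun x => g x 0 0) x = c0 at *
  generalize pd 0 (fun x => g x 0 1) x = c1 at *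
  generalize pd 0 (fun x => g x 1 1) x = c2 at *
  generalize pd 1 (fun x => g x 1 1) x = c3 at *
  generalize g x 0 0 = A at *
  generalize g x 0 1 = B at *
  generalize g x 1 1 = C at *
  -- By `h0` and `h1` the vector `(C, -2B, A)` is orthogonal to `(c0, c1, c2)` and `(c1, c2, c3)`.
  -- The relations `e1`, `e2`, `e3` express its proportionality to their cross product.
  have e1 : A * (c0 * c3 - c1 * c2) = 2 * B * (c0 * c2 - c1 ^ 2) := by
    linear_combination c0 * h1 - c1 * h0
  have e2 : A * (c1 * c3 - c2 ^ 2) = C * (c0 * c2 - c1 ^ 2) := by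
    linear_combination c1 * h1 - c2 * h0
  have e3 : C * (c0 * c3 - c1 * c2) = 2 * B * (c1 * c3 - c2 ^ 2) := by
    linear_combination c3 * h0 - c2 * h1
  refine ⟨?_, ?_, ?_⟩
  · linear_combination (-(1 / 4) * i ^ 2) * (A * e2 - B * e1) -
      (1 / 2 * i * (c0 * c2 - c1 ^ 2)) * hi
  · linear_combination (1 / 8 * i ^ 2) * (C * e1 + A * e3) -
      (1 / 4 * i * (c0 * c3 - c1 * c2)) * hi
  · linear_combination (-(1 / 4) * i ^ 2) * (-C * e2 - B * e3) -
      (1 / 2 * i * (c1 * c3 - c2 ^ 2)) * hi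

/-- The matrices `g⁻¹ ∂_b g` are trace-free, so Cayley-Hamilton gives `tr M² = -2 det M`. These
determinants and their polarization are the discriminants in `gaussCurvature_mul`. -/
theorem trace_logDeriv_mul (b c : Fin 2) :
    ∑ a, ∑ d, logDeriv g c a d x * logDeriv g b d a x = 4 * gaussCurvature g x * g x b c := by
  obtain ⟨k0, k1, k2⟩ := h.gaussCurvature_mul hx
  have h0 := h.pd_det 0 x hx
  have h1 := h.pd_det 1 x hx
  have hi : (g x).det⁻¹ * (g x 0 0 * g x 1 1 - g x 0 1 ^ 2) = 1 := by
    rw [← h.det_eq hx]; exact inv_mul_cancel₀ (h.det_ne_zero x hx)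
  fin_cases b <;> fin_cases c <;>
  simp [logDeriv, Matrix.inv_def, Matrix.adjugate_fin_two, h.symm x hx, h.pd_symm hx,
    h.pd_one_zero x hx, h.pd_one_one x hx] at h0 h1 ⊢ <;>
  generalize gaussCurvature g x = K at * <;>
  generalize (g x).det⁻¹ = i at * <;>
  generalize pd 0 (fun x => g x 0 0) x = c0 at * <;>
  generalize pd 0 (fun x => g x 0 1) x = c1 at * <;>
  generalize pd 0 (fun x => g x 1 1) x = c2 at * <;>
  generalize pd 1 (fun x => g x 1 1) x = c3 at * <;>
  generalize g x 0 0 = A at * <;>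
  generalize g x 0 1 = B at * <;>
  generalize g x 1 1 = C at *
  · grind
  · grind
  · grind
  · grind

end IsUnimodularHessian

/-! ### Laplacian of `log |g_cc|`, conformal change of the metric, and the fibre equation. -/

namespace IsUnimodularHessian

variable {g : (Fin 2 → ℝ) → Matrix (Fin 2) (Fin 2) ℝ} {U : Set (Fin 2 → ℝ)}
  (h : IsUnimodularHessian g U) {x : Fin 2 → ℝ} (hx : x ∈ U)

include h

theorem pd_log {c : Fin 2} (hc : ∀ x ∈ U, g x c c ≠ 0) (l m : Fin 2) (hx : x ∈ U) :
    pd l (pd m (fun x => Real.log (g x c c))) x =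
      (g x c c)⁻¹ * pd l (pd m (fun x => g x c c)) x -
        (g x c c)⁻¹ ^ 2 * pd l (fun x => g x c c) x * pd m (fun x => g x c c) x := by
  rw [(((h.hasPD hx c c).inv (hc x hx)).mul (h.hasPD_pd hx m c c)).congr h.isOpen hx
    (fun y hy => ((h.hasPD hy c c).log (hc y hy)).2 m) |>.2 l]
  ring

include hx

theorem inv_det_mul : (g x).det⁻¹ * (g x 0 0 * g x 1 1 - g x 0 1 ^ 2) = 1 := by
  rw [← h.det_eq hx]; exact inv_mul_cancel₀ (h.det_ne_zero x hx)

/-- By total symmetry `Δ g_cc = g^{μν} ∂_c ∂_c g_μν`, which the twice differentiated determinant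
identity turns into `4 K g_cc`. The once differentiated identity gives `|∇ g_cc|² = 2 K g_cc²`, and
`4K - 2K = 2K`. -/
theorem laplacian_log (c : Fin 2) (hc : ∀ x ∈ U, g x c c ≠ 0) :
    laplacian g (fun x => Real.log (g x c c)) x = 2 * gaussCurvature g x := by
  obtain ⟨k0, -, k2⟩ := h.gaussCurvature_mul hx
  have h0 := h.pd_det 0 x hx
  have h1 := h.pd_det 1 x hx
  have h00 := h.pd_pd_det hx 0 0
  have h11 := h.pd_pd_det hx 1 1
  have hi := h.inv_det_mul hx
  have hc' := hc x hx
  have hj : (g x c c)⁻¹ * g x c c = 1 := inv_mul_cancel₀ hc'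
  simp only [laplacian, h.pd_log hc _ _ hx]
  generalize gaussCurvature g x = K at *
  generalize (g x).det⁻¹ = i at *
  fin_cases c <;>
  simp [h.pd_one_zero x hx, h.pd_one_one x hx, h.pd_pd_one_zero hx, h.pd_pd_one_one hx,
    h.pd_one_pd_zero_01 hx, h.pd_zero_pd_one_11 hx, -inv_pow]
    at h0 h1 h00 h11 hc' hj ⊢ <;>
  generalize pd 0 (fun x => g x 0 0) x = c0 at * <;>
  generalize pd 0 (fun x => g x 0 1) x = c1 at * <;>
  generalize pd 0 (fun x => g x 1 1) x = c2 at * <;>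
  generalize pd 1 (fun x => g x 1 1) x = c3 at * <;>
  generalize g x 0 0 = A at * <;>
  generalize g x 0 1 = B at * <;>
  generalize g x 1 1 = C at *
  · generalize A⁻¹ = j at *
    linear_combination i * j * h00 - i * j ^ 2 * c0 * h0 + i * j * (c0 * c2 - c1 ^ 2) * hj -
      2 * j * k0 + 2 * K * hj
  · generalize C⁻¹ = j at *
    linear_combination i * j * h11 - i * j ^ 2 * c3 * h1 + i * j * (c1 * c3 - c2 ^ 2) * hj -
      2 * j * k2 + 2 * K * hj

variable (Φ : (Fin 2 → ℝ) → ℝ) (hΦ : ContDiffOn ℝ 2 Φ U)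

include hΦ

theorem hasPD_potential : HasPD Φ (fun m => pd m Φ x) x :=
  ((hΦ.differentiableOn (by norm_num)).differentiableAt (h.isOpen.mem_nhds hx)).hasPD

theorem hasPD_pd_potential (m : Fin 2) : HasPD (pd m Φ) (fun l => pd l (pd m Φ) x) x :=
  (((contDiffOn_pd hΦ h.isOpen (m := 1) (by norm_num) m).differentiableOn
    (by norm_num)).differentiableAt (h.isOpen.mem_nhds hx)).hasPD

omit hΦ in
theorem inv_baseMetric :
    (baseMetric g Φ x)⁻¹ = Real.exp (-(2 * Φ x)) • (g x)⁻¹ := by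
  apply Matrix.inv_eq_right_inv
  rw [baseMetric, Matrix.smul_mul, Matrix.mul_smul, smul_smul, ← Real.exp_add, add_neg_cancel,
    Real.exp_zero, one_smul, Matrix.mul_nonsing_inv _ (h.det_ne_zero x hx).isUnit]

theorem pd_baseMetric (m a b : Fin 2) : pd m (fun x => baseMetric g Φ x a b) x =
    Real.exp (2 * Φ x) * (pd m (fun x => g x a b) x + 2 * pd m Φ x * g x a b) := by
  have h1 : pd m (fun x => baseMetric g Φ x a b) x = _ :=
    (((HasPD.const 2 x).mul (h.hasPD_potential hx Φ hΦ)).exp.mul (h.hasPD hx a b)).2 m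
  rw [h1]
  ring

/-- The Christoffel symbols of `e^{2Φ} g`. -/
theorem christoffel_baseMetric (a b c : Fin 2) :
    christoffel (baseMetric g Φ) a b c x =
      1 / 2 * ((g x)⁻¹ a 0 * pd b (fun x => g x 0 c) x + (g x)⁻¹ a 1 * pd b (fun x => g x 1 c) x) +
      ((if a = c then 1 else 0) * pd b Φ x + (if a = b then 1 else 0) * pd c Φ x) -
      g x b c * ((g x)⁻¹ a 0 * pd 0 Φ x + (g x)⁻¹ a 1 * pd 1 Φ x) := by
  have hE : Real.exp (-(2 * Φ x)) * Real.exp (2 * Φ x) = 1 := by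
    rw [← Real.exp_add, neg_add_cancel, Real.exp_zero]
  have hi := h.inv_det_mul hx
  simp only [christoffel, Fin.sum_univ_two, h.inv_baseMetric hx Φ, h.pd_baseMetric hx Φ hΦ,
    Matrix.smul_apply, smul_eq_mul]
  generalize Real.exp (-(2 * Φ x)) = E at *
  generalize Real.exp (2 * Φ x) = F at *
  -- The factors `e^{-2Φ}` and `e^{2Φ}` cancel, leaving only the gradient of `Φ`.
  have key : ∀ p q u v : ℝ, 1 / 2 * (E * p * (F * u) + E * q * (F * v)) =
      1 / 2 * (p * u + q * v) := fun p q u v => by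
    linear_combination (1 / 2 * (p * u + q * v)) * hE
  simp only [← mul_add, ← mul_sub, key, Matrix.inv_def, Ring.inverse_eq_inv',
    Matrix.adjugate_fin_two, Matrix.smul_apply, smul_eq_mul]
  generalize (g x).det⁻¹ = i at *
  fin_cases a <;> fin_cases b <;> fin_cases c <;>
  simp [h.symm x hx, h.pd_symm hx, h.pd_one_zero x hx, h.pd_one_one x hx] <;>
  grind

theorem pd_christoffel_baseMetric (m a b c : Fin 2) :
    pd m (christoffel (baseMetric g Φ) a b c) x =
      1 / 2 * ((g x)⁻¹ a 0 * pd m (pd b (fun x => g x 0 c)) x +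
        pd b (fun x => g x 0 c) x * pd m (fun x => (g x)⁻¹ a 0) x +
        ((g x)⁻¹ a 1 * pd m (pd b (fun x => g x 1 c)) x +
        pd b (fun x => g x 1 c) x * pd m (fun x => (g x)⁻¹ a 1) x)) +
      ((if a = c then 1 else 0) * pd m (pd b Φ) x +
        (if a = b then 1 else 0) * pd m (pd c Φ) x) -
      (g x b c * ((g x)⁻¹ a 0 * pd m (pd 0 Φ) x + pd 0 Φ x * pd m (fun x => (g x)⁻¹ a 0) x +
        ((g x)⁻¹ a 1 * pd m (pd 1 Φ) x + pd 1 Φ x * pd m (fun x => (g x)⁻¹ a 1) x)) +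
        ((g x)⁻¹ a 0 * pd 0 Φ x + (g x)⁻¹ a 1 * pd 1 Φ x) * pd m (fun x => g x b c) x) := by
  have hP := fun l => (h.hasPD_inv hx a l).1.hasPD
  have hF := h.hasPD_pd_potential hx Φ hΦ
  have key := (((((HasPD.const (1 / 2) x).mul (((hP 0).mul (h.hasPD_pd hx b 0 c)).add
    ((hP 1).mul (h.hasPD_pd hx b 1 c)))).add
    (((HasPD.const (if a = c then 1 else 0) x).mul (hF b)).add
      ((HasPD.const (if a = b then 1 else 0) x).mul (hF c)))).sub
    ((h.hasPD hx b c).mul (((hP 0).mul (hF 0)).add ((hP 1).mul (hF 1))))).congr h.isOpen hx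
    fun y hy => h.christoffel_baseMetric hy Φ hΦ a b c).2 m
  rw [key]
  ring

/-- This is the conformal transformation law in dimension two; `Δ` has no first-order term because
`g^{bc} Γ^a_bc` of `g` is half the gradient of `log |det g|`. -/
theorem ricci_baseMetric (b c : Fin 2) : ricci (baseMetric g Φ) b c x =
    (gaussCurvature g x - laplacian g Φ x) * g x b c := by
  obtain ⟨k0, k1, k2⟩ := h.gaussCurvature_mul hx
  have h0 := h.pd_det 0 x hx
  have h1 := h.pd_det 1 x hx
  have h00 := h.pd_pd_det hx 0 0
  have h01 := h.pd_pd_det hx 0 1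
  have h11 := h.pd_pd_det hx 1 1
  have hi := h.inv_det_mul hx
  have hΦ10 := pd_comm hΦ h.isOpen hx 1 0
  simp only [ricci, Fin.sum_univ_two, h.christoffel_baseMetric hx Φ hΦ,
    h.pd_christoffel_baseMetric hx Φ hΦ, (h.hasPD_inv hx _ _).2, laplacian]
  simp only [Matrix.inv_def, Ring.inverse_eq_inv', Matrix.adjugate_fin_two, Matrix.smul_apply,
    smul_eq_mul, Matrix.of_apply]
  fin_cases b <;> fin_cases c <;>
  simp [h.symm x hx, h.pd_symm hx, h.pd_pd_symm hx, h.pd_one_zero x hx, h.pd_one_one x hx,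
    h.pd_pd_one_zero hx, h.pd_pd_one_one hx,
    h.pd_one_pd_zero_00 hx, h.pd_one_pd_zero_01 hx, h.pd_zero_pd_one_11 hx, hΦ10]
    at h0 h1 h00 h01 h11 ⊢ <;>
  generalize gaussCurvature g x = K at * <;>
  generalize (g x).det⁻¹ = i at * <;>
  generalize pd 0 (pd 0 (fun x => g x 0 0)) x = q0 at * <;>
  generalize pd 0 (pd 0 (fun x => g x 0 1)) x = q1 at * <;>
  generalize pd 0 (pd 0 (fun x => g x 1 1)) x = q2 at * <;>
  generalize pd 1 (pd 0 (fun x => g x 1 1)) x = q3 at * <;>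
  generalize pd 1 (pd 1 (fun x => g x 1 1)) x = q4 at * <;>
  generalize pd 0 (fun x => g x 0 0) x = c0 at * <;>
  generalize pd 0 (fun x => g x 0 1) x = c1 at * <;>
  generalize pd 0 (fun x => g x 1 1) x = c2 at * <;>
  generalize pd 1 (fun x => g x 1 1) x = c3 at * <;>
  generalize pd 0 (pd 0 Φ) x = F00 at * <;>
  generalize pd 0 (pd 1 Φ) x = F01 at * <;>
  generalize pd 1 (pd 1 Φ) x = F11 at * <;>
  generalize pd 0 Φ x = F0 at * <;>
  generalize pd 1 Φ x = F1 at * <;>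
  generalize g x 0 0 = A at * <;>
  generalize g x 0 1 = B at * <;>
  generalize g x 1 1 = C at * 
  -- Second derivatives of `g` cancel by total symmetry, so the twice differentiated determinant
  -- identities are not needed; each component needs one component of `gaussCurvature_mul`.
  · clear h00 h11 h01 k1 k2
    grind (ringSteps := 1000000)
  · clear h00 h11 h01 k0 k2
    grind (ringSteps := 1000000)
  · clear h00 h11 h01 k0 k2
    grind (ringSteps := 1000000)
  · clear h00 h11 h01 k0 k1
    grind (ringSteps := 1000000)

omit hΦ in
/-- The equation for the fibre components of the Ricci tensor. -/
theorem fibre_equation (hΦ : ContDiffOn ℝ 2 Φ U) (b c : Fin 2) :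
    ∑ a, pd a (gradMetric g Φ a b c) x +
      ∑ k, ∑ l, (christoffel (baseMetric g Φ) k k l x * gradMetric g Φ l b c x -
        1 / 2 * gradMetric g Φ k c l x * logDeriv g k l b x -
        1 / 2 * logDeriv g l k c x * gradMetric g Φ l b k x) = 0 := by
  have hgrad : ∀ y ∈ U, ∀ a b c, gradMetric g Φ a b c y = Real.exp (-(2 * Φ y)) *
      ((g y)⁻¹ a 0 * pd 0 (fun x => g x b c) y + (g y)⁻¹ a 1 * pd 1 (fun x => g x b c) y) := by
    intro y hy a b c
    simp only [gradMetric, h.inv_baseMetric hy Φ, Fin.sum_univ_two, Matrix.smul_apply, smul_eq_mul]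
    ring
  have hP := fun a l => (h.hasPD_inv hx a l).1.hasPD
  have hpd : ∀ a, pd a (gradMetric g Φ a b c) x = _ := fun a =>
    ((((HasPD.const 2 x).mul (h.hasPD_potential hx Φ hΦ)).neg.exp.mul
      (((hP a 0).mul (h.hasPD_pd hx 0 b c)).add ((hP a 1).mul (h.hasPD_pd hx 1 b c)))).congr
      h.isOpen hx fun y hy => hgrad y hy a b c).2 a
  have h0 := h.pd_det 0 x hx
  have h1 := h.pd_det 1 x hx
  have h00 := h.pd_pd_det hx 0 0
  have h01 := h.pd_pd_det hx 0 1
  have h11 := h.pd_pd_det hx 1 1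
  have hi := h.inv_det_mul hx
  simp only [Fin.sum_univ_two, h.christoffel_baseMetric hx Φ hΦ, hpd, hgrad x hx, logDeriv,
    (h.hasPD_inv hx _ _).2]
  simp only [Matrix.inv_def, Ring.inverse_eq_inv', Matrix.adjugate_fin_two, Matrix.smul_apply,
    smul_eq_mul, Matrix.of_apply]
  generalize Real.exp (-(2 * Φ x)) = E at *
  fin_cases b <;> fin_cases c <;>
  simp [h.symm x hx, h.pd_symm hx, h.pd_pd_symm hx, h.pd_one_zero x hx, h.pd_one_one x hx,
    h.pd_pd_one_zero hx, h.pd_pd_one_one hx,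
    h.pd_one_pd_zero_00 hx, h.pd_one_pd_zero_01 hx, h.pd_zero_pd_one_11 hx]
    at h0 h1 h00 h01 h11 ⊢ <;>
  generalize (g x).det⁻¹ = i at * <;>
  generalize pd 0 (pd 0 (fun x => g x 0 0)) x = q0 at * <;>
  generalize pd 0 (pd 0 (fun x => g x 0 1)) x = q1 at * <;>
  generalize pd 0 (pd 0 (fun x => g x 1 1)) x = q2 at * <;>
  generalize pd 1 (pd 0 (fun x => g x 1 1)) x = q3 at * <;>
  generalize pd 1 (pd 1 (fun x => g x 1 1)) x = q4 at * <;>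
  generalize pd 0 (fun x => g x 0 0) x = c0 at * <;>
  generalize pd 0 (fun x => g x 0 1) x = c1 at * <;>
  generalize pd 0 (fun x => g x 1 1) x = c2 at * <;>
  generalize pd 1 (fun x => g x 1 1) x = c3 at * <;>
  generalize pd 0 Φ x = F0 at * <;>
  generalize pd 1 Φ x = F1 at * <;>
  generalize g x 0 0 = A at * <;>
  generalize g x 0 1 = B at * <;>
  generalize g x 1 1 = C at *
  -- The terms in `∂Φ` from `e^{-2Φ}` and from `Γ^k_kl` cancel. Total symmetry gives `Δ g_bc =
  -- g^{kl} ∂_b ∂_c g_kl`, so component `(b, c)` needs just the determinant identity differentiated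
  -- along `b` and `c`.
  · clear h01 h11 hpd hgrad hP
    grind (ringSteps := 1000000)
  · clear h00 h11 hpd hgrad hP
    grind (ringSteps := 1000000)
  · clear h00 h11 hpd hgrad hP
    grind (ringSteps := 1000000)
  · clear h00 h01 hpd hgrad hP
    grind (ringSteps := 1000000)

end IsUnimodularHessian

/-! ### Linearity of the Laplacian -/

section Laplacian

variable {g : (Fin 2 → ℝ) → Matrix (Fin 2) (Fin 2) ℝ} {U : Set (Fin 2 → ℝ)} {x : Fin 2 → ℝ}

theorem laplacian_const_mul (c : ℝ) (f : (Fin 2 → ℝ) → ℝ) :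
    laplacian g (fun x => c * f x) x = c * laplacian g f x := by
  have h1 : ∀ m, pd m (fun x => c * f x) = fun x => c * pd m f x := fun m =>
    funext fun y => pd_const_mul m c f y
  simp only [laplacian, h1, pd_const_mul]
  ring

theorem pd_pd_congr {f f' : (Fin 2 → ℝ) → ℝ} (hU : IsOpen U) (hx : x ∈ U)
    (h : ∀ y ∈ U, f y = f' y) (l m : Fin 2) : pd l (pd m f) x = pd l (pd m f') x :=
  pd_congr l hU hx fun _ hy => pd_congr m hU hy h

theorem laplacian_congr {f f' : (Fin 2 → ℝ) → ℝ} (hU : IsOpen U) (hx : x ∈ U)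
    (h : ∀ y ∈ U, f y = f' y) : laplacian g f x = laplacian g f' x := by
  simp only [laplacian, pd_pd_congr hU hx h]

theorem laplacian_add {f f' : (Fin 2 → ℝ) → ℝ} (hU : IsOpen U) (hx : x ∈ U)
    (hf : ContDiffOn ℝ 2 f U) (hf' : ContDiffOn ℝ 2 f' U) :
    laplacian g (fun x => f x + f' x) x = laplacian g f x + laplacian g f' x := by
  have hd : ∀ {f : (Fin 2 → ℝ) → ℝ}, ContDiffOn ℝ 2 f U → ∀ y ∈ U,
      HasPD f (fun m => pd m f y) y := fun hf y hy =>
    ((hf.differentiableOn (by norm_num)).differentiableAt (hU.mem_nhds hy)).hasPD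
  have hdd : ∀ {f : (Fin 2 → ℝ) → ℝ}, ContDiffOn ℝ 2 f U → ∀ m,
      HasPD (pd m f) (fun l => pd l (pd m f) x) x := fun hf m =>
    (((contDiffOn_pd hf hU (m := 1) (by norm_num) m).differentiableOn
      (by norm_num)).differentiableAt (hU.mem_nhds hx)).hasPD
  have key : ∀ l m, pd l (pd m (fun x => f x + f' x)) x = pd l (pd m f) x + pd l (pd m f') x :=
    fun l m => (((hdd hf m).add (hdd hf' m)).congr hU hx
      fun y hy => ((hd hf y hy).add (hd hf' y hy)).2 m).2 l
  simp only [laplacian, key]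
  ring

end Laplacian

/-! ### Minimal graphs -/

section Graph

variable {g₀ : Matrix (Fin 2) (Fin 2) ℝ} {ε : ℝ} {φ : (Fin 2 → ℝ) → ℝ}

theorem rho_eq (hsymm : g₀.IsSymm) (x : Fin 2 → ℝ) :
    rho g₀ ε φ x = 1 + ε * g₀.det⁻¹ * (g₀ 1 1 * (pd 0 φ x * pd 0 φ x) -
      2 * g₀ 0 1 * (pd 0 φ x * pd 1 φ x) + g₀ 0 0 * (pd 1 φ x * pd 1 φ x)) := by
  have h10 : g₀ 1 0 = g₀ 0 1 := hsymm.apply 0 1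
  simp only [rho, Fin.sum_univ_two, Matrix.inv_def, Ring.inverse_eq_inv',
    Matrix.adjugate_fin_two, Matrix.smul_apply, smul_eq_mul]
  simp [h10]
  ring

/-- The matrix determinant lemma for the rank-one perturbation `ε ∂φ ∂φᵀ` of `g₀`. -/
theorem det_graphMetric (hsymm : g₀.IsSymm) (hdet : g₀.det ≠ 0) (x : Fin 2 → ℝ) :
    graphMetric g₀ ε φ x 0 0 * graphMetric g₀ ε φ x 1 1 - graphMetric g₀ ε φ x 0 1 ^ 2 =
      g₀.det * rho g₀ ε φ x := by
  have h10 : g₀ 1 0 = g₀ 0 1 := hsymm.apply 0 1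
  have hi : g₀.det * g₀.det⁻¹ = 1 := mul_inv_cancel₀ hdet
  rw [rho_eq hsymm]
  simp only [graphMetric, Matrix.of_apply]
  have hd : g₀.det = g₀ 0 0 * g₀ 1 1 - g₀ 0 1 * g₀ 0 1 := by rw [Matrix.det_fin_two, h10]
  linear_combination (-ε * (g₀ 1 1 * (pd 0 φ x * pd 0 φ x) -
      2 * g₀ 0 1 * (pd 0 φ x * pd 1 φ x) + g₀ 0 0 * (pd 1 φ x * pd 1 φ x))) * hi - hd

theorem conformalMetric_apply (x : Fin 2 → ℝ) (a b : Fin 2) :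
    conformalMetric g₀ ε φ x a b = 1 / √|rho g₀ ε φ x| * graphMetric g₀ ε φ x a b := rfl

theorem graphMetric_symm (hsymm : g₀.IsSymm) (x : Fin 2 → ℝ) (a b : Fin 2) :
    graphMetric g₀ ε φ x a b = graphMetric g₀ ε φ x b a := by
  simp only [graphMetric, Matrix.of_apply, hsymm.apply a b]
  rw [← hsymm.apply a b]
  ring

theorem det_conformalMetric_ne_zero (hsymm : g₀.IsSymm) (hdet : g₀.det ≠ 0) {x : Fin 2 → ℝ}
    (hρ : rho g₀ ε φ x ≠ 0) : (conformalMetric g₀ ε φ x).det ≠ 0 := by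
  have hu : 1 / √|rho g₀ ε φ x| ≠ 0 := by positivity
  rw [conformalMetric, Matrix.det_smul, Matrix.det_fin_two, graphMetric_symm hsymm x 1 0,
    ← sq, det_graphMetric hsymm hdet]
  exact mul_ne_zero (pow_ne_zero _ hu) (mul_ne_zero hdet hρ)

variable {U : Set (Fin 2 → ℝ)} {k : WithTop ℕ∞}

theorem contDiffOn_graphMetric (hU : IsOpen U) (hφ : ContDiffOn ℝ (k + 1) φ U) (a b : Fin 2) :
    ContDiffOn ℝ k (fun x => graphMetric g₀ ε φ x a b) U := by
  simp only [graphMetric, Matrix.of_apply]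
  exact contDiffOn_const.add ((contDiffOn_const.mul (contDiffOn_pd hφ hU le_rfl a)).mul
    (contDiffOn_pd hφ hU le_rfl b))

theorem contDiffOn_rho (hU : IsOpen U) (hφ : ContDiffOn ℝ (k + 1) φ U) :
    ContDiffOn ℝ k (rho g₀ ε φ) U :=
  contDiffOn_const.add (contDiffOn_const.mul (ContDiffOn.sum fun a _ => ContDiffOn.sum fun b _ =>
    (contDiffOn_const.mul (contDiffOn_pd hφ hU le_rfl a)).mul (contDiffOn_pd hφ hU le_rfl b)))

theorem contDiffOn_conformalMetric (hU : IsOpen U) (hφ : ContDiffOn ℝ (k + 1) φ U)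
    (hρ : ∀ x ∈ U, rho g₀ ε φ x ≠ 0) (a b : Fin 2) :
    ContDiffOn ℝ k (fun x => conformalMetric g₀ ε φ x a b) U := by
  simp only [conformalMetric_apply]
  refine ContDiffOn.mul (contDiffOn_const.div (ContDiffOn.sqrt ?_ ?_) ?_)
    (contDiffOn_graphMetric hU hφ a b)
  · simp only [← Real.sqrt_mul_self_eq_abs]
    exact ((contDiffOn_rho hU hφ).mul (contDiffOn_rho hU hφ)).sqrt fun x hx =>
      mul_self_ne_zero.2 (hρ x hx)
  · exact fun x hx => abs_ne_zero.2 (hρ x hx)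
  · exact fun x hx => by have := hρ x hx; positivity

theorem hasDerivAt_one_div_sqrt_abs {t : ℝ} (ht : t ≠ 0) :
    HasDerivAt (fun t : ℝ => 1 / √|t|) (-(1 / √|t|) / (2 * t)) t := by
  have hs : √|t| ≠ 0 := by positivity
  have h1 := ((hasDerivAt_abs ht).sqrt (abs_ne_zero.2 ht)).inv hs
  simp only [one_div]
  refine h1.congr_deriv ?_
  have h2 : √|t| ^ 2 = |t| := Real.sq_sqrt (abs_nonneg t)
  rw [h2]
  rcases lt_or_gt_of_ne ht with h | h
  · rw [abs_of_neg h] at *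
    simp [h]
    field_simp
  · rw [abs_of_pos h] at *
    simp [h]
    field_simp

/-- Minimality as a polynomial equation. -/
theorem minimal_equation (hsymm : g₀.IsSymm) (hdet : g₀.det ≠ 0) {x : Fin 2 → ℝ}
    (hρ : rho g₀ ε φ x ≠ 0) (hH : meanCurvature g₀ ε φ x = 0)
    (hcomm : pd 1 (pd 0 φ) x = pd 0 (pd 1 φ) x) :
    graphMetric g₀ ε φ x 1 1 * pd 0 (pd 0 φ) x -
      2 * graphMetric g₀ ε φ x 0 1 * pd 0 (pd 1 φ) x +
      graphMetric g₀ ε φ x 0 0 * pd 1 (pd 1 φ) x = 0 := by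
  have hu : 1 / √|rho g₀ ε φ x| ≠ 0 := by positivity
  have hd : (graphMetric g₀ ε φ x).det ≠ 0 := by
    rw [Matrix.det_fin_two, graphMetric_symm hsymm x 1 0, ← sq, det_graphMetric hsymm hdet]
    exact mul_ne_zero hdet hρ
  have h1 := (mul_eq_zero.1 hH).resolve_left hu
  simp only [Fin.sum_univ_two, Matrix.inv_def, Ring.inverse_eq_inv', Matrix.adjugate_fin_two,
    Matrix.smul_apply, smul_eq_mul, graphMetric_symm hsymm x 1 0, hcomm] at h1
  simp at h1
  have h2 := inv_ne_zero hd
  refine (mul_eq_zero.1 (?_ : (graphMetric g₀ ε φ x).det⁻¹ * _ = 0)).resolve_left h2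
  linear_combination h1

section HasPD

variable (hU : IsOpen U) (hφ : ContDiffOn ℝ 3 φ U) {x : Fin 2 → ℝ} (hx : x ∈ U)

include hU hφ hx

theorem hasPD_pd (m : Fin 2) : HasPD (pd m φ) (fun l => pd l (pd m φ) x) x :=
  (((contDiffOn_pd hφ hU (m := 2) (by norm_num) m).differentiableOn
    (by norm_num)).differentiableAt (hU.mem_nhds hx)).hasPD

theorem hasPD_graphMetric (a b : Fin 2) : HasPD (fun x => graphMetric g₀ ε φ x a b)
    (fun l => ε * (pd a φ x * pd l (pd b φ) x + pd b φ x * pd l (pd a φ) x)) x := by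
  simp only [graphMetric, Matrix.of_apply]
  exact ((HasPD.const (g₀ a b) x).add (((HasPD.const ε x).mul (hasPD_pd hU hφ hx a)).mul
    (hasPD_pd hU hφ hx b))).congr_deriv fun l => by ring

theorem hasPD_rho (hsymm : g₀.IsSymm) : HasPD (rho g₀ ε φ)
    (fun l => 2 * ε * g₀.det⁻¹ * (g₀ 1 1 * (pd 0 φ x * pd l (pd 0 φ) x) -
      g₀ 0 1 * (pd 0 φ x * pd l (pd 1 φ) x + pd 1 φ x * pd l (pd 0 φ) x) +
      g₀ 0 0 * (pd 1 φ x * pd l (pd 1 φ) x))) x := by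
  have h0 := hasPD_pd hU hφ hx 0
  have h1 := hasPD_pd hU hφ hx 1
  refine HasPD.congr hU hx ?_ fun y _ => rho_eq hsymm y
  exact ((HasPD.const 1 x).add ((HasPD.const (ε * g₀.det⁻¹) x).mul
    ((((HasPD.const (g₀ 1 1) x).mul (h0.mul h0)).sub
      ((HasPD.const (2 * g₀ 0 1) x).mul (h0.mul h1))).add
      ((HasPD.const (g₀ 0 0) x).mul (h1.mul h1))))).congr_deriv fun l => by ring

theorem pd_conformalMetric (hsymm : g₀.IsSymm) (hρ : rho g₀ ε φ x ≠ 0) (m a b : Fin 2) :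
    pd m (fun x => conformalMetric g₀ ε φ x a b) x =
      1 / √|rho g₀ ε φ x| * (ε * (pd a φ x * pd m (pd b φ) x + pd b φ x * pd m (pd a φ) x) -
        graphMetric g₀ ε φ x a b * ((2 * rho g₀ ε φ x)⁻¹ * pd m (rho g₀ ε φ) x)) := by
  have h1 := ((HasPD.comp (hasDerivAt_one_div_sqrt_abs hρ) (hasPD_rho hU hφ hx hsymm)).mul
    (hasPD_graphMetric (g₀ := g₀) (ε := ε) hU hφ hx a b)).2 m
  rw [(hasPD_rho hU hφ hx hsymm).2 m]
  refine Eq.trans h1 ?_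
  ring

end HasPD

/-- Constancy of the determinant needs only the normalization, as `det h / |ρ| = ± det g₀`. Each of
the two symmetry conditions on `∂_a g_bc` follows from minimality, its defect being a multiple of
the minimal surface equation. -/
theorem isUnimodularHessian_conformalMetric (hsymm : g₀.IsSymm) (hdet : g₀.det ≠ 0)
    (hU : IsOpen U) (hφ : ContDiffOn ℝ 3 φ U) (hρ : ∀ x ∈ U, rho g₀ ε φ x ≠ 0)
    (hH : ∀ x ∈ U, meanCurvature g₀ ε φ x = 0) :
    IsUnimodularHessian (conformalMetric g₀ ε φ) U := by
  have hcomm : ∀ x ∈ U, pd 1 (pd 0 φ) x = pd 0 (pd 1 φ) x := fun x hx =>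
    pd_comm (hφ.of_le (by norm_num)) hU hx 1 0
  -- The derivative of `det h = det g₀ · ρ`, with `h` in place of `g₀` on the right: the terms cubic
  -- in `∂φ` cancel.
  have hρm : ∀ x ∈ U, ∀ m, g₀.det * pd m (rho g₀ ε φ) x =
      ε * (graphMetric g₀ ε φ x 1 1 * (2 * pd 0 φ x * pd m (pd 0 φ) x) -
        2 * graphMetric g₀ ε φ x 0 1 * (pd 0 φ x * pd m (pd 1 φ) x + pd 1 φ x * pd m (pd 0 φ) x) +
        graphMetric g₀ ε φ x 0 0 * (2 * pd 1 φ x * pd m (pd 1 φ) x)) := by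
    intro x hx m
    have hi : g₀.det * g₀.det⁻¹ = 1 := mul_inv_cancel₀ hdet
    rw [(hasPD_rho hU hφ hx hsymm).2 m]
    simp only [graphMetric, Matrix.of_apply]
    linear_combination (2 * ε * (g₀ 1 1 * (pd 0 φ x * pd m (pd 0 φ) x) -
      g₀ 0 1 * (pd 0 φ x * pd m (pd 1 φ) x + pd 1 φ x * pd m (pd 0 φ) x) +
      g₀ 0 0 * (pd 1 φ x * pd m (pd 1 φ) x))) * hi
  refine ⟨hU, contDiffOn_conformalMetric hU (hφ.of_le (by norm_num)) hρ, ?_, ?_, ?_, ?_, ?_⟩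
  · intro x _
    rw [conformalMetric_apply, graphMetric_symm hsymm, conformalMetric_apply]
  · exact fun x hx => det_conformalMetric_ne_zero hsymm hdet (hρ x hx)
  · intro x hx
    have h0 := hρm x hx 0
    have h1 := hρm x hx 1
    have hE := minimal_equation hsymm hdet (hρ x hx) (hH x hx) (hcomm x hx)
    have hD := det_graphMetric (ε := ε) (φ := φ) hsymm hdet x
    have hr := hρ x hx
    have hj : 2 * rho g₀ ε φ x * (2 * rho g₀ ε φ x)⁻¹ = 1 :=
      mul_inv_cancel₀ (mul_ne_zero two_ne_zero hr)
    rw [pd_conformalMetric hU hφ hx hsymm hr, pd_conformalMetric hU hφ hx hsymm hr]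
    congr 1
    rw [hcomm x hx] at *
    -- Multiplying by `2 ρ det g₀` clears the denominator from differentiating `1 / √|ρ|` and makes
    -- the claim a polynomial identity modulo `hE`.
    refine mul_left_cancel₀ (mul_ne_zero hdet (mul_ne_zero two_ne_zero hr)) ?_
    linear_combination (-g₀.det * graphMetric g₀ ε φ x 0 0 * pd 1 (rho g₀ ε φ) x +
        g₀.det * graphMetric g₀ ε φ x 0 1 * pd 0 (rho g₀ ε φ) x) * hj -
      2 * ε * (pd 0 φ x * pd 0 (pd 1 φ) x - pd 1 φ x * pd 0 (pd 0 φ) x) * hD -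
      graphMetric g₀ ε φ x 0 0 * h1 + graphMetric g₀ ε φ x 0 1 * h0 -
      2 * ε * (pd 1 φ x * graphMetric g₀ ε φ x 0 0 - pd 0 φ x * graphMetric g₀ ε φ x 0 1) * hE
  · intro x hx
    have h0 := hρm x hx 0
    have h1 := hρm x hx 1
    have hE := minimal_equation hsymm hdet (hρ x hx) (hH x hx) (hcomm x hx)
    have hD := det_graphMetric (ε := ε) (φ := φ) hsymm hdet x
    have hr := hρ x hx
    have hj : 2 * rho g₀ ε φ x * (2 * rho g₀ ε φ x)⁻¹ = 1 :=
      mul_inv_cancel₀ (mul_ne_zero two_ne_zero hr)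
    rw [pd_conformalMetric hU hφ hx hsymm hr, pd_conformalMetric hU hφ hx hsymm hr]
    congr 1
    rw [hcomm x hx] at *
    refine mul_left_cancel₀ (mul_ne_zero hdet (mul_ne_zero two_ne_zero hr)) ?_
    linear_combination (-g₀.det * graphMetric g₀ ε φ x 0 1 * pd 1 (rho g₀ ε φ) x +
        g₀.det * graphMetric g₀ ε φ x 1 1 * pd 0 (rho g₀ ε φ) x) * hj -
      2 * ε * (pd 0 φ x * pd 1 (pd 1 φ) x - pd 1 φ x * pd 0 (pd 1 φ) x) * hD -
      graphMetric g₀ ε φ x 0 1 * h1 + graphMetric g₀ ε φ x 1 1 * h0 +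
      2 * ε * (pd 0 φ x * graphMetric g₀ ε φ x 1 1 - pd 1 φ x * graphMetric g₀ ε φ x 0 1) * hE
  · intro m x hx
    have hm := hρm x hx m
    have hD := det_graphMetric (ε := ε) (φ := φ) hsymm hdet x
    have hr := hρ x hx
    have hj : 2 * rho g₀ ε φ x * (2 * rho g₀ ε φ x)⁻¹ = 1 :=
      mul_inv_cancel₀ (mul_ne_zero two_ne_zero hr)
    simp only [pd_conformalMetric hU hφ hx hsymm hr]
    simp only [conformalMetric_apply]
    generalize 1 / √|rho g₀ ε φ x| = u
    linear_combination (-u ^ 2) * hm -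
      2 * u ^ 2 * (2 * rho g₀ ε φ x)⁻¹ * pd m (rho g₀ ε φ) x * hD -
      u ^ 2 * g₀.det * pd m (rho g₀ ε φ) x * hj

/-- The height function of a minimal graph is harmonic, and harmonicity is unaffected by the
conformal factor. -/
theorem laplacian_graph (hsymm : g₀.IsSymm) (hdet : g₀.det ≠ 0) {x : Fin 2 → ℝ}
    (hρ : rho g₀ ε φ x ≠ 0) (hH : meanCurvature g₀ ε φ x = 0)
    (hcomm : pd 1 (pd 0 φ) x = pd 0 (pd 1 φ) x) :
    laplacian (conformalMetric g₀ ε φ) φ x = 0 := by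
  simp only [laplacian, conformalMetric_apply]
  linear_combination ((conformalMetric g₀ ε φ x).det⁻¹ * (1 / √|rho g₀ ε φ x|)) *
    minimal_equation hsymm hdet hρ hH hcomm

end Graph

/-! ### Ricci flatness from the equation for `Φ`, and the powers of `w` and `ρ` as exponentials. -/

section Main

variable {n : ℕ} {e : Fin n → ℝ} {g : (Fin 2 → ℝ) → Matrix (Fin 2) (Fin 2) ℝ}
  {Φ : (Fin 2 → ℝ) → ℝ} {U : Set (Fin 2 → ℝ)} {k : WithTop ℕ∞}

theorem isPseudoRiemannianOn_totalMetric (he : ∀ i, e i = 1 ∨ e i = -1)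
    (hg : ∀ a b, ContDiffOn ℝ k (fun x => g x a b) U) (hΦ : ContDiffOn ℝ k Φ U)
    (hsymm : ∀ x ∈ U, (g x).IsSymm) (hdet : ∀ x ∈ U, (g x).det ≠ 0) :
    IsPseudoRiemannianOn k (totalMetric e g Φ) {z | base z ∈ U} := by
  refine ⟨?_, ?_, fun z hz => det_totalMetric_ne_zero Φ he (hdet _ hz)⟩
  · rintro (a | ⟨a, i⟩) (b | ⟨b, j⟩)
    · exact contDiffOn_comp_base (f := fun x => Real.exp (2 * Φ x) * g x a b)
        ((contDiffOn_const.mul hΦ).exp.mul (hg a b))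
    · exact contDiffOn_const
    · exact contDiffOn_const
    · simp only [totalMetric_inr_inr]
      split_ifs
      · exact contDiffOn_const.mul (contDiffOn_comp_base (hg a b))
      · exact contDiffOn_const
  · intro z hz
    refine Matrix.IsSymm.fromBlocks ((hsymm _ hz).smul _) (by simp) ?_
    rw [Matrix.IsSymm, Matrix.blockDiagonal_transpose]
    simp only [Matrix.transpose_smul, (hsymm _ hz).eq]

theorem IsUnimodularHessian.isRicciFlatOn_totalMetric (h : IsUnimodularHessian g U)
    (he : ∀ i, e i = 1 ∨ e i = -1) (hΦ : ContDiffOn ℝ 2 Φ U)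
    (hL : ∀ x ∈ U, laplacian g Φ x = (1 - n) * gaussCurvature g x) :
    IsRicciFlatOn (totalMetric e g Φ) {z | base z ∈ U} := by
  have htr : ∀ b, ∀ x ∈ U, logDeriv g b 0 0 x + logDeriv g b 1 1 x = 0 :=
    fun b x hx => h.trace_logDeriv hx b
  rintro z (hz : base z ∈ U) (b | ⟨b, i⟩) (c | ⟨c, j⟩)
  · rw [ricci_inl_inl Φ h.isOpen he h.det_ne_zero hz htr, h.ricci_baseMetric hz Φ hΦ,
      h.trace_logDeriv_mul hz, hL _ hz]
    ring
  · exact ricci_inl_inr Φ h.isOpen he h.det_ne_zero hz b _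
  · exact ricci_inr_inl Φ h.isOpen he h.det_ne_zero hz c _
  · rw [ricci_inr_inr Φ h.isOpen he h.det_ne_zero hz htr, h.fibre_equation hz Φ hΦ, mul_zero,
      ite_self]

theorem IsUnimodularHessian.laplacian_mul_log (h : IsUnimodularHessian g U) (a : ℝ) (c : Fin 2)
    (hc : a ≠ 0 → ∀ x ∈ U, g x c c ≠ 0) {x : Fin 2 → ℝ} (hx : x ∈ U) :
    laplacian g (fun x => a * Real.log (g x c c)) x = 2 * a * gaussCurvature g x := by
  rw [laplacian_const_mul]
  -- With coefficient zero, `g_cc` is allowed to vanish.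
  by_cases ha : a = 0
  · simp [ha]
  · rw [h.laplacian_log hx c (hc ha)]
    ring

theorem contDiffOn_mul_log {f : (Fin 2 → ℝ) → ℝ} (hf : ContDiffOn ℝ k f U) (a : ℝ)
    (hc : a ≠ 0 → ∀ x ∈ U, f x ≠ 0) : ContDiffOn ℝ k (fun x => a * Real.log (f x)) U := by
  by_cases ha : a = 0
  · simpa [ha] using contDiffOn_const
  · exact contDiffOn_const.mul (hf.log (hc ha))

/-- For `m = 0` both sides are `1`, even at `t = 0`; this realizes the convention for powers of a
vanishing `w`. -/
theorem abs_rpow_eq_exp {t m : ℝ} (h : m ≠ 0 → t ≠ 0) : |t| ^ m = Real.exp (m * Real.log t) := by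
  by_cases hm : m = 0
  · simp [hm]
  · rw [Real.rpow_def_of_pos (abs_pos.2 (h hm)), Real.log_abs, mul_comm]

theorem log_div_sqrt_abs {t r : ℝ} (ht : t ≠ 0) (hr : r ≠ 0) :
    Real.log (1 / √|r| * t) = Real.log t - 1 / 2 * Real.log r := by
  rw [Real.log_mul (by positivity) ht, one_div, Real.log_inv, Real.log_sqrt (abs_nonneg r),
    Real.log_abs]
  ring

end Main

end RicciFlatGraph

theorem mainTheorem1
    (g₀ : Matrix (Fin 2) (Fin 2) ℝ) (hsymm : g₀.IsSymm) (hdet : g₀.det ≠ 0)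
    (ε : ℝ) (hε : ε = 1 ∨ ε = -1)
    (U : Set (Fin 2 → ℝ)) (hU : IsOpen U)
    (k : WithTop ℕ∞) (hk : 2 ≤ k)
    (φ : (Fin 2 → ℝ) → ℝ) (hφ : ContDiffOn ℝ (k + 1) φ U)
    (hρ : ∀ x ∈ U, RicciFlatGraph.rho g₀ ε φ x ≠ 0)
    (hH : ∀ x ∈ U, RicciFlatGraph.meanCurvature g₀ ε φ x = 0)
    (n : ℕ) (e : Fin n → ℝ) (he : ∀ i, e i = 1 ∨ e i = -1)
    (e₀ m₁ m₂ n₁ n₂ : ℝ) (hm : m₁ + m₂ = 0) (hn : n₁ + n₂ = ((n : ℝ) - 1) / 2)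
    (hw₁ : m₁ ≠ 0 ∨ n₁ ≠ 0 → ∀ x ∈ U, RicciFlatGraph.w g₀ ε φ 0 x ≠ 0)
    (hw₂ : m₂ ≠ 0 ∨ n₂ ≠ 0 → ∀ x ∈ U, RicciFlatGraph.w g₀ ε φ 1 x ≠ 0) :
    ∃ ψ Φ : (Fin 2 → ℝ) → ℝ,
      (∀ x ∈ U, Real.exp (2 * ψ x) = Real.exp (2 * e₀ * φ x) *
        |RicciFlatGraph.w g₀ ε φ 0 x| ^ (-2 * m₁) *
        |RicciFlatGraph.w g₀ ε φ 1 x| ^ (-2 * m₂)) ∧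
      (∀ x ∈ U, Real.exp (2 * Φ x) = Real.exp (2 * ψ x) *
        |RicciFlatGraph.w g₀ ε φ 0 x| ^ (-2 * n₁) *
        |RicciFlatGraph.w g₀ ε φ 1 x| ^ (-2 * n₂) *
        |RicciFlatGraph.rho g₀ ε φ x| ^ (n₁ + n₂)) ∧
      RicciFlatGraph.IsPseudoRiemannianOn k
        (RicciFlatGraph.totalMetric e (RicciFlatGraph.conformalMetric g₀ ε φ) Φ)
        {z | RicciFlatGraph.base z ∈ U} ∧
      RicciFlatGraph.IsRicciFlatOn
        (RicciFlatGraph.totalMetric e (RicciFlatGraph.conformalMetric g₀ ε φ) Φ)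
        {z | RicciFlatGraph.base z ∈ U} := by
  have hφ3 : ContDiffOn ℝ 3 φ U :=
    hφ.of_le (by simpa using! (add_le_add_left hk 1 : (2 : WithTop ℕ∞) + 1 ≤ k + 1))
  have hφk : ContDiffOn ℝ k φ U := hφ.of_le le_self_add
  have hG := RicciFlatGraph.contDiffOn_conformalMetric hU hφ hρ
  have hess := RicciFlatGraph.isUnimodularHessian_conformalMetric hsymm hdet hU hφ3 hρ hH
  have hdiag : ∀ x α, RicciFlatGraph.conformalMetric g₀ ε φ x α α =
      1 / √|RicciFlatGraph.rho g₀ ε φ x| * RicciFlatGraph.w g₀ ε φ α x := fun x α => by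
    rw [RicciFlatGraph.conformalMetric_apply]
    simp only [RicciFlatGraph.graphMetric, Matrix.of_apply, RicciFlatGraph.w]
    ring
  have hsum : ∀ {a b : ℝ}, a + b ≠ 0 → a ≠ 0 ∨ b ≠ 0 := fun {a b} hab => by
    by_contra! hc
    exact hab (by rw [hc.1, hc.2, add_zero])
  have hc : ∀ (m ν : ℝ) (α : Fin 2),
      (m ≠ 0 ∨ ν ≠ 0 → ∀ x ∈ U, RicciFlatGraph.w g₀ ε φ α x ≠ 0) → -(m + ν) ≠ 0 →
        ∀ x ∈ U, RicciFlatGraph.conformalMetric g₀ ε φ x α α ≠ 0 := by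
    intro m ν α hw h x hx
    have := hρ x hx
    rw [hdiag]
    exact mul_ne_zero (by positivity) (hw (hsum (neg_ne_zero.1 h)) x hx)
  have hlog : ∀ (m ν : ℝ) (α : Fin 2),
      (m ≠ 0 ∨ ν ≠ 0 → ∀ x ∈ U, RicciFlatGraph.w g₀ ε φ α x ≠ 0) → ∀ x ∈ U,
        -(m + ν) * Real.log (RicciFlatGraph.conformalMetric g₀ ε φ x α α) =
          -m * Real.log (RicciFlatGraph.w g₀ ε φ α x) -
            ν * Real.log (RicciFlatGraph.w g₀ ε φ α x) +
            (m + ν) / 2 * Real.log (RicciFlatGraph.rho g₀ ε φ x) := by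
    intro m ν α hw x hx
    by_cases h : m ≠ 0 ∨ ν ≠ 0
    · rw [hdiag, RicciFlatGraph.log_div_sqrt_abs (hw h x hx) (hρ x hx)]
      ring
    · push Not at h
      simp [h.1, h.2]
  -- Half the logarithms of the prescribed formulas; `Real.log t = Real.log |t|` takes care of the
  -- absolute values.
  let ψ : (Fin 2 → ℝ) → ℝ := fun x => e₀ * φ x -
    m₁ * Real.log (RicciFlatGraph.w g₀ ε φ 0 x) - m₂ * Real.log (RicciFlatGraph.w g₀ ε φ 1 x)
  let Φ : (Fin 2 → ℝ) → ℝ := fun x => ψ x -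
    n₁ * Real.log (RicciFlatGraph.w g₀ ε φ 0 x) - n₂ * Real.log (RicciFlatGraph.w g₀ ε φ 1 x) +
    (n₁ + n₂) / 2 * Real.log (RicciFlatGraph.rho g₀ ε φ x)
  -- Replacing `w` by `g_cc` also produces `(m₁ + m₂) / 2 * log |ρ|`, which vanishes by `hm`; the
  -- `n` part is matched by the factor `|ρ| ^ (n₁ + n₂)`.
  have hΦ_eq : ∀ x ∈ U, Φ x = e₀ * φ x +
      (-(m₁ + n₁) * Real.log (RicciFlatGraph.conformalMetric g₀ ε φ x 0 0) +
        -(m₂ + n₂) * Real.log (RicciFlatGraph.conformalMetric g₀ ε φ x 1 1)) := by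
    intro x hx
    rw [hlog m₁ n₁ 0 hw₁ x hx, hlog m₂ n₂ 1 hw₂ x hx]
    simp only [Φ, ψ]
    linear_combination (-(1 / 2) * Real.log (RicciFlatGraph.rho g₀ ε φ x)) * hm
  have hC0 := fun {l : WithTop ℕ∞} (hl : l ≤ k) =>
    RicciFlatGraph.contDiffOn_mul_log ((hG 0 0).of_le hl) (-(m₁ + n₁)) (hc m₁ n₁ 0 hw₁)
  have hC1 := fun {l : WithTop ℕ∞} (hl : l ≤ k) =>
    RicciFlatGraph.contDiffOn_mul_log ((hG 1 1).of_le hl) (-(m₂ + n₂)) (hc m₂ n₂ 1 hw₂)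
  have hCφ := fun {l : WithTop ℕ∞} (hl : l ≤ k) =>
    (contDiffOn_const (c := e₀)).mul (hφk.of_le hl)
  have hΦ : ContDiffOn ℝ k Φ U :=
    ((hCφ le_rfl).add ((hC0 le_rfl).add (hC1 le_rfl))).congr hΦ_eq
  refine ⟨ψ, Φ, fun x hx => ?_, fun x hx => ?_, ?_, ?_⟩
  · rw [RicciFlatGraph.abs_rpow_eq_exp fun h => hw₁ (Or.inl (by simpa using h)) x hx,
      RicciFlatGraph.abs_rpow_eq_exp fun h => hw₂ (Or.inl (by simpa using h)) x hx,
      ← Real.exp_add, ← Real.exp_add]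
    simp only [ψ]
    ring_nf
  · rw [RicciFlatGraph.abs_rpow_eq_exp fun h => hw₁ (Or.inr (by simpa using h)) x hx,
      RicciFlatGraph.abs_rpow_eq_exp fun h => hw₂ (Or.inr (by simpa using h)) x hx,
      RicciFlatGraph.abs_rpow_eq_exp fun _ => hρ x hx,
      ← Real.exp_add, ← Real.exp_add, ← Real.exp_add]
    simp only [Φ]
    ring_nf
  · refine RicciFlatGraph.isPseudoRiemannianOn_totalMetric he hG hΦ (fun x _ => ?_)
      hess.det_ne_zero
    exact Matrix.IsSymm.ext fun a b => by
      rw [RicciFlatGraph.conformalMetric_apply, RicciFlatGraph.graphMetric_symm hsymm,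
        RicciFlatGraph.conformalMetric_apply]
  · refine hess.isRicciFlatOn_totalMetric he (hΦ.of_le hk) fun x hx => ?_
    rw [RicciFlatGraph.laplacian_congr hU hx hΦ_eq,
      RicciFlatGraph.laplacian_add hU hx (hCφ hk) ((hC0 hk).add (hC1 hk)),
      RicciFlatGraph.laplacian_add hU hx (hC0 hk) (hC1 hk),
      hess.laplacian_mul_log _ 0 (hc m₁ n₁ 0 hw₁) hx,
      hess.laplacian_mul_log _ 1 (hc m₂ n₂ 1 hw₂) hx,
      RicciFlatGraph.laplacian_const_mul,
      RicciFlatGraph.laplacian_graph hsymm hdet (hρ x hx) (hH x hx)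
        (RicciFlatGraph.pd_comm (hφ3.of_le (by norm_num)) hU hx 1 0)]
    -- `ΔΦ = -2 (m₁ + n₁ + m₂ + n₂) K`, and the sum of the constants is `(n - 1) / 2`.
    linear_combination (-2 * RicciFlatGraph.gaussCurvature
      (RicciFlatGraph.conformalMetric g₀ ε φ) x) * (hm + hn)
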